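/- Let $\varphi:[0,\infty)\to[0,\infty)$ be continuous and strictly increasing, and let $W(x)=\exp(\varphi(|x|))$, $x\in\mathbb R$. Assume that $$\lim_{|t|\to\infty}\frac{t^m}{W(t)}=0\quad\text{for all } m\in\mathbb N,\qquad\text{and}\qquad \int_{-\infty}^{\infty}\frac{\log W(t)}{1+t^2}\,dt=\infty .$$ For a function $f:\mathbb R\to\mathbb C$ put $\|f\|_{\infty,W}=\sup_{t\in\mathbb R}|f(t)/W(t)|$ and $\|f\|_{p,W}=\left(\int_{\mathbb R}|f(x)/W(x)|^p\,dx\right)^{1/p}$ for $1\le p<\infty$. For $1\le p\le\infty$ and $n\in\mathbb N$ let $$E_n(p,W)=\inf_Q\left\|\frac1{x-i}-Q(x)\right\|_{p,W},$$ where $Q$ runs over all polynomials with complex coefficients of degree at most $n-1$. Call $\varphi$ *rapidly growing* if, for some $\varepsilon>0$ and $A>0$, the function $\varphi(x)/x^{1+\varepsilon}$ is increasing on $[A,\infty)$; call $\varphi$ *normally growing* if, for some $A>0$, on $[A,\infty)$ the function $\varphi(x)/x^2$ is decreasing and $\varphi(x)$ is a convex function of $\log x$ (here "increasing" and "decreasing"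 are meant in the weak sense). Let $\varphi^{-1}:[\varphi(0),\infty)\to[0,\infty)$ be the inverse of $\varphi$. (a) If $\varphi$ is rapidly growing, then there are constants $c,C>0$ and $N\in\mathbb N$, depending only on $\varphi$, such that for all $n\ge N$ and all $p\in[1,\infty]$ $$-C\,\frac{n}{\varphi^{-1}(n)}\le \log E_n(p,W)\le -c\,\frac{n}{\varphi^{-1}(n)} .$$ (b) If $\varphi$ is normally growing, then there are constants $c,C>0$ and $N\in\mathbb N$, depending only on $\varphi$, such that for all $n\ge N$ and all $p\in[1,\infty]$ $$-C\int_0^{\varphi^{-1}(n)}\frac{\varphi(x)}{x^2+1}\,dx\le \log E_n(p,W)\le -c\int_0^{\varphi^{-1}(n)}\frac{\varphi(x)}{x^2+1}\,dx .$$ -/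

import Mathlib

open MeasureTheory Filter Topology Set
open scoped ENNReal

noncomputable section

namespace WeightedApprox

/-- The function `W(x) = exp (φ(|x|))` on the real line. -/
def weight (φ : ℝ → ℝ) (x : ℝ) : ℝ := Real.exp (φ |x|)

/-- `W = exp (φ(|·|))` is a weight: `φ` (of which only the values on `[0, ∞)` matter) is
nonnegative, continuous and strictly increasing on `[0, ∞)`, the function `W` grows faster than
every polynomial, and the logarithmic integral of `W` diverges. -/
structure IsWeight (φ : ℝ → ℝ) : Prop where
  continuousOn : ContinuousOn φ (Ici 0)
  strictMonoOn : StrictMonoOn φ (Ici 0)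
  nonneg : ∀ x, 0 ≤ x → 0 ≤ φ x
  superpolynomial : ∀ n : ℕ, Tendsto (fun t : ℝ => t ^ n / weight φ t) (cocompact ℝ) (𝓝 0)
  log_integral_eq_top :
    ∫⁻ t : ℝ, ENNReal.ofReal (Real.log (weight φ t) / (1 + t ^ 2)) = ∞

/-- `φ` grows normally: for some `A > 0`, on `[A, ∞)` the function `φ(x) / x²` is decreasing and
`φ(x)` is a convex function of `log x`. -/
def NormallyGrowing (φ : ℝ → ℝ) : Prop :=
  ∃ A : ℝ, 0 < A ∧ AntitoneOn (fun x => φ x / x ^ 2) (Ici A) ∧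
    ConvexOn ℝ (Ici (Real.log A)) (fun t => φ (Real.exp t))

/-- `φ` grows rapidly: for some `ε > 0` and `A > 0`, the function `φ(x) / x^(1+ε)` is increasing
on `[A, ∞)`. -/
def RapidlyGrowing (φ : ℝ → ℝ) : Prop :=
  ∃ ε A : ℝ, 0 < ε ∧ 0 < A ∧ MonotoneOn (fun x => φ x / x ^ (1 + ε)) (Ici A)

/-- The weighted norm `‖f‖_{p,W}`: the supremum of `|f / W|` over the line for `p = ∞`, and the
`L^p` norm of `f / W` with respect to Lebesgue measure for finite `p`. -/
def weightedNorm (p : ℝ≥0∞) (W : ℝ → ℝ) (f : ℝ → ℂ) : ℝ≥0∞ :=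
  if p = ∞ then ⨆ t : ℝ, ‖f t / (W t : ℂ)‖ₑ
  else eLpNorm (fun t : ℝ => f t / (W t : ℂ)) p volume

/-- The error `E_n(p, W)` of the best approximation of the Cauchy kernel `1 / (x - i)` by complex
polynomials of degree at most `n - 1` (that is, of degree `< n`) in the norm `‖·‖_{p,W}`. -/
def bestError (n : ℕ) (p : ℝ≥0∞) (W : ℝ → ℝ) : ℝ :=
  (⨅ Q ∈ Polynomial.degreeLT ℂ n,
    weightedNorm p W (fun x : ℝ => 1 / ((x : ℂ) - Complex.I) - Q.eval (x : ℂ))).toReal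

/-- The inverse `φ⁻¹ : [φ(0), ∞) → [0, ∞)` of the restriction of `φ` to `[0, ∞)`. -/
def inverse (φ : ℝ → ℝ) (y : ℝ) : ℝ := Function.invFunOn φ (Ici 0) y

end WeightedApprox

end

/-! A polynomial `Q` of degree below `n` corresponds to `P = 1 - (x - i) Q` of degree at most `n`
with `P(i) = 1`, and `1/(x - i) - Q = P/(x - i)`. Thus `E_n` measures how small a polynomial of
degree at most `n`, normalised at `i`, can be relative to `W` on the line.

Lower bound (`exists_exp_le_bestError`, any weight, any `a ≥ 1`): in the complement of `[-a, a]`,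
the subharmonic function `log |P|` at `i` is controlled by its harmonic average over the interval
plus the contribution of the pole of order at most `n` at infinity. The Joukowsky map carries this
to the disc, where it becomes a Jensen inequality with Poisson kernel. Up to constants the pole
costs `n/a`, the weight costs `∫_0^a φ/(1 + x²)`, and the ends of the interval cost `φ(a)/a`. The
choice `a = φ⁻¹(n)` balances the first and last terms.

Upper bound (`exists_bestError_le`): it suffices to find `P` with `|P| ≤ B exp(φ/2)` on the line and
`|P(i)|` large. The exponential `exp(-i m z/(3t))` has modulus one on the line and is large at `i`;
its Taylor polynomial of degree `m` keeps these properties up to `|x| = t`, and beyond `t` grows at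
most like `(2|x|/t)^m`. For rapid growth one such polynomial with `t = φ⁻¹(n)`, `m ≈ n/2` suffices.
For normal growth a product over the dyadic scales `T 2^k` is used, the degrees up to each scale
being proportional to the increment of `φ` there. Summation by parts bounds the product on the line
by `exp(φ/2)` up to a constant, and at `i` produces `∑ φ(T 2^k)/(T 2^k)`, a discrete form of the
integral. -/

noncomputable section

namespace WeightedApprox

/-! ### Truncated exponentials: the test polynomials at one scale. -/

/-- The Taylor polynomial of degree `m` of `z ↦ exp (-i m z / (3 t))` at the origin. -/
def expTrunc (m : ℕ) (t : ℝ) : Polynomial ℂ :=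
  ∑ l ∈ Finset.range (m + 1),
    Polynomial.C ((-Complex.I * (m / (3 * t) : ℝ)) ^ l / l.factorial) * Polynomial.X ^ l

lemma natDegree_expTrunc_le (m : ℕ) (t : ℝ) : (expTrunc m t).natDegree ≤ m := by
  refine Polynomial.natDegree_sum_le_of_forall_le _ _ fun l hl => ?_
  exact (Polynomial.natDegree_C_mul_X_pow_le _ _).trans (by simp at hl; omega)

lemma eval_expTrunc (m : ℕ) (t : ℝ) (z : ℂ) :
    (expTrunc m t).eval z =
      ∑ l ∈ Finset.range (m + 1), (-Complex.I * (m / (3 * t) : ℝ) * z) ^ l / l.factorial := by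
  simp only [expTrunc, Polynomial.eval_finsetSum, Polynomial.eval_mul, Polynomial.eval_C,
    Polynomial.eval_pow, Polynomial.eval_X]
  exact Finset.sum_congr rfl fun l _ => by rw [mul_pow _ z]; ring

lemma hasSum_exp_tail (x : ℝ) (m : ℕ) :
    HasSum (fun l : ℕ => x ^ (l + m) / (l + m).factorial)
      (Real.exp x - ∑ l ∈ Finset.range m, x ^ l / l.factorial) := by
  have h := NormedSpace.expSeries_div_hasSum_exp (𝔸 := ℝ) x
  rw [← Real.exp_eq_exp_ℝ] at h
  exact (hasSum_nat_add_iff' m).2 h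

lemma exp_tail_mul_le {u v : ℝ} (hu : 0 ≤ u) (hu1 : u ≤ 1) (hv : 0 ≤ v) (m : ℕ) :
    Real.exp (u * v) - ∑ l ∈ Finset.range m, (u * v) ^ l / l.factorial ≤
      u ^ m * (Real.exp v - ∑ l ∈ Finset.range m, v ^ l / l.factorial) := by
  refine hasSum_le (fun l => ?_) (hasSum_exp_tail (u * v) m)
    ((hasSum_exp_tail v m).mul_left (u ^ m))
  rw [mul_pow, mul_div_assoc, pow_add u]
  have : u ^ l ≤ 1 := pow_le_one₀ hu hu1
  have h2 : 0 ≤ u ^ m * (v ^ (l + m) / (l + m).factorial) := by positivity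
  nlinarith

/-- The tail starts at degree `m + 1`, so shrinking the argument by a factor gains the power `m + 1`
of that factor. Shrinking `m` by `1/3` already beats `exp m ≤ 3 ^ m`, which explains the `3` in
`expTrunc`; shrinking further by `y` gains `y ^ (m + 1)`. The square is retained so that these
errors are summable over dyadic scales. -/
lemma exp_tail_le {m : ℕ} (hm : 1 ≤ m) {y : ℝ} (hy : 0 ≤ y) (hy1 : y ≤ 1) :
    Real.exp (y * (m / 3)) - ∑ l ∈ Finset.range (m + 1), (y * (m / 3)) ^ l / l.factorial ≤
      y ^ 2 := by
  have h1 := exp_tail_mul_le hy hy1 (v := (m : ℝ) / 3) (by positivity) (m + 1)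
  have h2 := exp_tail_mul_le (u := 1 / 3) (v := m) (by norm_num) (by norm_num) (by positivity)
    (m + 1)
  rw [show (1 / 3 : ℝ) * m = m / 3 by ring] at h2
  have h3 : 0 ≤ ∑ l ∈ Finset.range (m + 1), (m : ℝ) ^ l / l.factorial := by positivity
  have h4 : Real.exp m ≤ 3 ^ m := by
    rw [← Real.exp_one_pow]
    exact pow_le_pow_left₀ (by positivity) (Real.exp_one_lt_d9.le.trans (by norm_num)) _
  have h5 : (1 / 3 : ℝ) ^ (m + 1) * (3 : ℝ) ^ m = 1 / 3 := by
    rw [pow_succ, mul_right_comm, ← mul_pow]; norm_num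
  have h6 : (1 / 3 : ℝ) ^ (m + 1) *
      (Real.exp m - ∑ l ∈ Finset.range (m + 1), (m : ℝ) ^ l / l.factorial) ≤ 1 := by
    have : (1 / 3 : ℝ) ^ (m + 1) *
      (Real.exp m - ∑ l ∈ Finset.range (m + 1), (m : ℝ) ^ l / l.factorial) ≤
        (1 / 3 : ℝ) ^ (m + 1) * (3 : ℝ) ^ m := by gcongr; linarith
    linarith
  have h7 : y ^ (m + 1) ≤ y ^ 2 := pow_le_pow_of_le_one hy hy1 (by omega)
  calc _ ≤ _ := h1
    _ ≤ y ^ (m + 1) * 1 := by gcongr; linarith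
    _ ≤ y ^ 2 := by linarith

/-- The full exponential has modulus one at real points, so only the Taylor tail contributes. -/
lemma norm_eval_expTrunc_le_of_abs_le (m : ℕ) {t x : ℝ} (ht : 0 < t) (hx : |x| ≤ t) :
    ‖(expTrunc m t).eval (x : ℂ)‖ ≤ Real.exp ((x / t) ^ 2) := by
  rcases Nat.eq_zero_or_pos m with rfl | hm
  · simp [eval_expTrunc]; positivity
  rw [eval_expTrunc]
  set z : ℂ := -Complex.I * (m / (3 * t) : ℝ) * x with hz
  have hzn : ‖z‖ = |x| / t * (m / 3) := by
    rw [hz, norm_mul, norm_mul, norm_neg, Complex.norm_I, Complex.norm_real, Complex.norm_real,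
      Real.norm_eq_abs, Real.norm_eq_abs, abs_of_nonneg (by positivity)]
    field_simp
  have h1 := Complex.norm_exp_sub_sum_le_exp_norm_sub_sum z (m + 1)
  have hz1 : ‖Complex.exp z‖ = 1 := by
    have : z = ((-(m / (3 * t) * x) : ℝ) : ℂ) * Complex.I := by rw [hz]; push_cast; ring
    rw [this, Complex.norm_exp_ofReal_mul_I]
  have h2 := exp_tail_le hm (y := |x| / t) (by positivity) ((div_le_one ht).2 hx)
  rw [← hzn] at h2
  have h3 : (|x| / t) ^ 2 = (x / t) ^ 2 := by rw [div_pow, div_pow, sq_abs]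
  have h4 := norm_sub_norm_le (∑ l ∈ Finset.range (m + 1), z ^ l / l.factorial) (Complex.exp z)
  rw [norm_sub_rev] at h4
  have h5 := Real.add_one_le_exp ((x / t) ^ 2)
  linarith

/-- Every power of `|x|/t` is at most the `m`-th one; the remaining coefficients sum to at most
`exp(m/3) ≤ 2^m`. -/
lemma norm_eval_expTrunc_le_of_le_abs (m : ℕ) {t x : ℝ} (ht : 0 < t) (hx : t ≤ |x|) :
    ‖(expTrunc m t).eval (x : ℂ)‖ ≤ Real.exp (m * Real.log (2 * |x| / t)) := by
  have hy1 : 1 ≤ |x| / t := (one_le_div ht).2 hx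
  rw [eval_expTrunc]
  have h0 : Real.exp (m * Real.log (2 * |x| / t)) = (|x| / t) ^ m * 2 ^ m := by
    rw [mul_comm, Real.exp_mul, Real.exp_log (by rw [mul_div_assoc]; positivity),
      Real.rpow_natCast, mul_div_assoc, mul_pow, mul_comm]
  rw [h0]
  have hexp : Real.exp ((m : ℝ) / 3) ≤ 2 ^ m := by
    rw [div_eq_mul_inv, Real.exp_mul, ← Real.exp_one_pow, ← Real.rpow_natCast,
      ← Real.rpow_mul (by positivity), mul_comm, Real.rpow_mul (by positivity), Real.rpow_natCast]
    gcongr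
    have : Real.exp 1 ≤ 2 ^ (3 : ℝ) := by
      have := Real.exp_one_lt_d9
      norm_num; linarith
    calc Real.exp 1 ^ (3 : ℝ)⁻¹ ≤ (2 ^ (3 : ℝ)) ^ (3 : ℝ)⁻¹ := by gcongr
      _ = 2 := by rw [← Real.rpow_mul (by norm_num)]; norm_num
  calc _ ≤ ∑ l ∈ Finset.range (m + 1), (|x| / t) ^ m * (((m : ℝ) / 3) ^ l / l.factorial) := by
        refine norm_sum_le_of_le _ fun l hl => ?_
        have hlm : l ≤ m := by simp at hl; omega
        have : ‖-Complex.I * ((m / (3 * t) : ℝ) : ℂ) * x‖ = |x| / t * (m / 3) := by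
          rw [norm_mul, norm_mul, norm_neg, Complex.norm_I, Complex.norm_real, Complex.norm_real,
            Real.norm_eq_abs, Real.norm_eq_abs, abs_of_nonneg (by positivity)]
          field_simp
        rw [norm_div, norm_pow, this, Complex.norm_natCast, mul_pow, mul_div_assoc]
        gcongr
    _ = (|x| / t) ^ m * ∑ l ∈ Finset.range (m + 1), (((m : ℝ) / 3) ^ l / l.factorial) := by
        rw [Finset.mul_sum]
    _ ≤ (|x| / t) ^ m * 2 ^ m := by
        gcongr
        exact (Real.sum_le_exp_of_nonneg (by positivity) _).trans hexp

/-- At `i` all Taylor terms are positive. Since `m.choose l ≤ m ^ l / l!`, they dominate the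
binomial expansion of `(1 + 1/(3t))^m`, and `exp s ≤ 1 + 2s` for `0 ≤ s ≤ 1/2` finishes with `s =
1/(6t)`. -/
lemma exp_le_norm_eval_expTrunc_I (m : ℕ) {t : ℝ} (ht : 1 ≤ t) :
    Real.exp (m / (6 * t)) ≤ ‖(expTrunc m t).eval Complex.I‖ := by
  have ht0 : 0 < t := by linarith
  have hev : (expTrunc m t).eval Complex.I =
      ((∑ l ∈ Finset.range (m + 1), ((m : ℝ) / (3 * t)) ^ l / l.factorial : ℝ) : ℂ) := by
    rw [eval_expTrunc]
    have : -Complex.I * ((m / (3 * t) : ℝ) : ℂ) * Complex.I = ((m / (3 * t) : ℝ) : ℂ) := by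
      rw [mul_right_comm, neg_mul, Complex.I_mul_I]; simp
    rw [this]; push_cast; rfl
  rw [hev, Complex.norm_real, Real.norm_eq_abs]
  refine le_trans ?_ (le_abs_self _)
  have h1 : (1 + 1 / (3 * t)) ^ m ≤
      ∑ l ∈ Finset.range (m + 1), ((m : ℝ) / (3 * t)) ^ l / l.factorial := by
    rw [add_comm, add_pow]
    refine Finset.sum_le_sum fun l _ => ?_
    have := Nat.choose_le_pow_div (α := ℝ) l m
    rw [one_pow, mul_one, div_pow, div_pow, one_pow]
    calc 1 / (3 * t) ^ l * (m.choose l : ℝ) ≤ 1 / (3 * t) ^ l * (m ^ l / l.factorial) := by gcongr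
      _ = _ := by field_simp
  refine le_trans ?_ h1
  have h2 : Real.exp (1 / (6 * t)) ≤ 1 + 1 / (3 * t) := by
    have hs : (1 : ℝ) / (6 * t) ≤ 1 / 2 := by
      rw [div_le_div_iff₀ (by positivity) (by norm_num)]; linarith
    have h3 := Real.one_sub_le_exp_neg (1 / (6 * t))
    rw [Real.exp_neg] at h3
    have h4 : Real.exp (1 / (6 * t)) ≤ 1 / (1 - 1 / (6 * t)) := by
      rw [le_div_iff₀ (by linarith)]
      have := Real.exp_pos (1 / (6 * t))
      calc _ ≤ Real.exp (1 / (6 * t)) * (Real.exp (1 / (6 * t)))⁻¹ := by gcongr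
        _ = 1 := by field_simp
    refine h4.trans ?_
    rw [div_le_iff₀ (by linarith)]
    have e : 1 / (3 * t) = 2 * (1 / (6 * t)) := by field_simp; norm_num
    have : 0 < 1 / (6 * t) := by positivity
    rw [e]; nlinarith
  calc Real.exp (m / (6 * t)) = Real.exp (1 / (6 * t)) ^ m := by
        rw [← Real.exp_nat_mul]; congr 1; ring
    _ ≤ _ := by gcongr

/-! ### A Jensen inequality in the unit disc with Poisson kernel. -/

lemma continuousOn_poissonKernel {w : ℂ} (hw : ‖w‖ < 1) :
    ContinuousOn (poissonKernel 0 w) (Metric.sphere 0 1) := by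
  have : poissonKernel 0 w = fun z => (‖z - 0‖ ^ 2 - ‖w - 0‖ ^ 2) / ‖(z - 0) - (w - 0)‖ ^ 2 := by
    ext z; exact poissonKernel_def 0 w z
  rw [this]
  refine ContinuousOn.div (by fun_prop) (by fun_prop) fun z hz => ?_
  simp only [mem_sphere_iff_norm, sub_zero] at hz
  have : z ≠ w := by rintro rfl; linarith
  simpa [sub_eq_zero] using this

lemma continuous_poissonKernel_circleMap {w : ℂ} (hw : ‖w‖ < 1) :
    Continuous fun θ : ℝ => poissonKernel 0 w (circleMap 0 1 θ) := by
  refine (continuousOn_poissonKernel hw).comp_continuous (continuous_circleMap 0 1) fun θ => ?_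
  exact circleMap_mem_sphere 0 zero_le_one θ

lemma poissonKernel_circleMap_nonneg {w : ℂ} (hw : ‖w‖ < 1) (θ : ℝ) :
    0 ≤ poissonKernel 0 w (circleMap 0 1 θ) := by
  rw [poissonKernel_def]
  refine div_nonneg ?_ (by positivity)
  simp only [sub_zero, norm_circleMap_zero, abs_one]
  nlinarith [norm_nonneg w]

lemma circleAverage_poissonKernel_log_of_harmonic {w : ℂ} (hw : ‖w‖ < 1) {g : ℂ → ℂ}
    (hg : ∀ z, AnalyticAt ℂ g z) (hg0 : ∀ z, ‖z‖ ≤ 1 → g z ≠ 0) :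
    Real.circleAverage (fun z => poissonKernel 0 w z * Real.log ‖g z‖) 0 1 = Real.log ‖g w‖ := by
  have h : InnerProductSpace.HarmonicOnNhd (fun z => Real.log ‖g z‖) (Metric.closedBall 0 1) := by
    intro z hz
    exact AnalyticAt.harmonicAt_log_norm (hg z) (hg0 z (by simpa using hz))
  exact h.circleAverage_poissonKernel_smul (by simpa using hw)

lemma circleAverage_poissonKernel_mul_const {w : ℂ} (hw : ‖w‖ < 1) (c : ℝ) :
    Real.circleAverage (fun z => poissonKernel 0 w z * c) 0 1 = c := by
  have := circleAverage_poissonKernel_log_of_harmonic hw (g := fun _ => (Real.exp c : ℂ))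
    (fun z => by fun_prop) (fun z _ => by exact_mod_cast (Real.exp_pos c).ne')
  simpa [Complex.norm_real] using this

/-- For a root inside the disc, `z - ρ` is replaced by `1 - conj ρ * z`, which has the same modulus
on the circle, no zero in the closed disc, and a larger modulus inside. For a root outside, `log ‖z
- ρ‖` is harmonic on the closed disc; for a root on the circle equality persists despite the
singularity. -/
lemma log_norm_sub_le_circleAverage {w : ℂ} (hw : ‖w‖ < 1) {ρ : ℂ} (hρ : w ≠ ρ) :
    Real.log ‖w - ρ‖ ≤
      Real.circleAverage (fun z => poissonKernel 0 w z * Real.log ‖z - ρ‖) 0 1 := by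
  have hwb : w ∈ Metric.ball (0 : ℂ) 1 := by simpa using hw
  rcases lt_trichotomy ‖ρ‖ 1 with h | h | h
  · have hmono : ‖w - ρ‖ ≤ ‖1 - (starRingEnd ℂ) ρ * w‖ := by
      rw [← sq_le_sq₀ (norm_nonneg _) (norm_nonneg _), ← Complex.normSq_eq_norm_sq,
        ← Complex.normSq_eq_norm_sq]
      have h1 : ‖w‖ ^ 2 < 1 := by nlinarith [norm_nonneg w]
      have h2 : ‖ρ‖ ^ 2 < 1 := by nlinarith [norm_nonneg ρ]
      rw [← Complex.normSq_eq_norm_sq, Complex.normSq_apply] at h1 h2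
      simp only [Complex.normSq_apply, Complex.sub_re, Complex.sub_im, Complex.one_re,
        Complex.one_im, Complex.mul_re, Complex.mul_im, Complex.conj_re, Complex.conj_im]
      nlinarith [mul_nonneg (sub_nonneg.2 h1.le) (sub_nonneg.2 h2.le)]
    have heq := circleAverage_poissonKernel_log_of_harmonic hw
      (g := fun z => 1 - (starRingEnd ℂ) ρ * z) (fun z => by fun_prop) (fun z hz h0 => by
        have : ‖(starRingEnd ℂ) ρ * z‖ = 1 := by rw [← sub_eq_zero.1 h0]; simp
        rw [norm_mul, RCLike.norm_conj] at this
        nlinarith [norm_nonneg ρ, norm_nonneg z])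
    calc Real.log ‖w - ρ‖ ≤ Real.log ‖1 - (starRingEnd ℂ) ρ * w‖ :=
          Real.log_le_log (norm_pos_iff.2 (sub_ne_zero.2 hρ)) hmono
      _ = _ := heq.symm
      _ = _ := by
        refine Real.circleAverage_congr_sphere fun z hz => ?_
        have hz1 : ‖z‖ = 1 := by simpa using hz
        have hzz : (starRingEnd ℂ) z * z = 1 := by
          rw [mul_comm, Complex.mul_conj, Complex.normSq_eq_norm_sq, hz1]; simp
        have : 1 - (starRingEnd ℂ) ρ * z = (starRingEnd ℂ) (z - ρ) * z := by
          rw [map_sub, sub_mul, hzz]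
        simp only [this, norm_mul, RCLike.norm_conj, hz1, mul_one]
  · have := circleAverage_re_herglotzRieszKernel_mul_log (w := w) (ρ := ρ) (c := 0) (R := 1)
      (by simpa using h) hwb
    rw [← poissonKernel_eq_re_herglotzRieszKernel] at this
    exact this.ge
  · refine (circleAverage_poissonKernel_log_of_harmonic hw (g := fun z => z - ρ)
      (fun z => by fun_prop) (fun z hz h0 => ?_)).ge
    rw [sub_eq_zero.1 h0] at hz
    linarith

lemma circleIntegrable_poissonKernel_mul {w : ℂ} (hw : ‖w‖ < 1) {g : ℂ → ℝ}
    (hg : CircleIntegrable g 0 1) :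
    CircleIntegrable (fun z => poissonKernel 0 w z * g z) 0 1 :=
  IntervalIntegrable.continuousOn_mul hg (continuous_poissonKernel_circleMap hw).continuousOn

/-- A Jensen type inequality for polynomials in the unit disc. -/
lemma log_norm_eval_le_of_circleAverage_le {w : ℂ} (hw : ‖w‖ < 1) {F : Polynomial ℂ}
    (hF : F.eval w ≠ 0) {ψ : ℂ → ℝ} (hψ : Continuous ψ) {lam : ℝ} (hlam : 0 < lam)
    (h : Real.circleAverage
      (fun z => poissonKernel 0 w z * (‖F.eval z‖ * Real.exp (-ψ z))) 0 1 ≤ lam) :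
    Real.log ‖F.eval w‖ ≤
      Real.log lam + Real.circleAverage (fun z => poissonKernel 0 w z * ψ z) 0 1 := by
  have hF0 : F ≠ 0 := by rintro rfl; simp at hF
  have hspl := IsAlgClosed.splits F
  have hev : ∀ z, F.eval z = F.leadingCoeff * (F.roots.map fun ρ => z - ρ).prod := fun z => by
    conv_lhs => rw [hspl.eq_prod_roots]
    simp [Polynomial.eval_multiset_prod, Multiset.map_map]
  have hlog : ∀ z, F.eval z ≠ 0 → Real.log ‖F.eval z‖ =
      Real.log ‖F.leadingCoeff‖ + (F.roots.map fun ρ => Real.log ‖z - ρ‖).sum := by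
    intro z hz
    have hroots : ∀ s : Multiset ℂ, (∀ ρ ∈ s, z ≠ ρ) →
        Real.log ‖(s.map fun ρ => z - ρ).prod‖ = (s.map fun ρ => Real.log ‖z - ρ‖).sum ∧
          (s.map fun ρ => z - ρ).prod ≠ 0 := by
      intro s
      induction s using Multiset.induction_on with
      | empty => simp
      | cons a s ih =>
        intro hs
        obtain ⟨h1, h2⟩ := ih fun ρ hρ => hs ρ (Multiset.mem_cons_of_mem hρ)
        have h3 : z - a ≠ 0 := sub_ne_zero.2 (hs a (Multiset.mem_cons_self a s))
        simp only [Multiset.map_cons, Multiset.prod_cons, Multiset.sum_cons, norm_mul]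
        exact ⟨by rw [Real.log_mul (norm_ne_zero_iff.2 h3) (norm_ne_zero_iff.2 h2), h1],
          mul_ne_zero h3 h2⟩
    obtain ⟨h1, h2⟩ := hroots F.roots fun ρ hρ hzρ => hz (by
      rw [hzρ]; exact (Polynomial.mem_roots hF0).1 hρ)
    rw [hev z, norm_mul, Real.log_mul (by simpa using hF0) (norm_ne_zero_iff.2 h2), h1]
  have hci : ∀ s : Multiset ℂ,
      CircleIntegrable (fun z => (s.map fun ρ => Real.log ‖z - ρ‖).sum) 0 1 := by
    intro s
    induction s using Multiset.induction_on with
    | empty => simp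
    | cons a s ih =>
      simp only [Multiset.map_cons, Multiset.sum_cons]
      exact (circleIntegrable_log_norm_sub_const 1).add ih
  have hsum : ∀ s : Multiset ℂ, (∀ ρ ∈ s, w ≠ ρ) → (s.map fun ρ => Real.log ‖w - ρ‖).sum ≤
      Real.circleAverage
        (fun z => poissonKernel 0 w z * (s.map fun ρ => Real.log ‖z - ρ‖).sum) 0 1 := by
    intro s
    induction s using Multiset.induction_on with
    | empty => simp [Real.circleAverage_const]
    | cons a s ih =>
      intro hs
      have h1 := ih fun ρ hρ => hs ρ (Multiset.mem_cons_of_mem hρ)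
      have h2 := log_norm_sub_le_circleAverage hw (hs a (Multiset.mem_cons_self a s))
      simp only [Multiset.map_cons, Multiset.sum_cons, mul_add]
      have := Real.circleAverage_add
        (circleIntegrable_poissonKernel_mul hw (circleIntegrable_log_norm_sub_const (a := a) 1))
        (circleIntegrable_poissonKernel_mul hw (hci s))
      simp only [Pi.add_def] at this
      rw [this]
      linarith
  -- `G` is `log ‖F‖` written through the roots. The two agree off the zeros of `F`, and this form
  -- gives integrability on the circle.
  set G : ℂ → ℝ := fun z =>
    Real.log ‖F.leadingCoeff‖ + (F.roots.map fun ρ => Real.log ‖z - ρ‖).sum with hG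
  have hGi : CircleIntegrable G 0 1 := (circleIntegrable_const _ 0 1).add (hci _)
  have h1 : Real.log ‖F.eval w‖ ≤ Real.circleAverage (fun z => poissonKernel 0 w z * G z) 0 1 := by
    rw [hlog w hF]
    simp only [hG, mul_add]
    have := Real.circleAverage_add
        (circleIntegrable_poissonKernel_mul hw
          (circleIntegrable_const (Real.log ‖F.leadingCoeff‖) 0 1))
        (circleIntegrable_poissonKernel_mul hw (hci F.roots))
    simp only [Pi.add_def] at this
    rw [this, circleAverage_poissonKernel_mul_const hw]
    gcongr
    exact hsum _ fun ρ hρ hwρ => hF (by rw [hwρ]; exact (Polynomial.mem_roots hF0).1 hρ)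
  have hu : Continuous fun z => ‖F.eval z‖ * Real.exp (-ψ z) := by fun_prop
  have ciψ : CircleIntegrable (fun z => poissonKernel 0 w z * ψ z) 0 1 :=
    circleIntegrable_poissonKernel_mul hw hψ.continuousOn.circleIntegrable'
  have ciu : CircleIntegrable
      (fun z => poissonKernel 0 w z * (‖F.eval z‖ * Real.exp (-ψ z))) 0 1 :=
    circleIntegrable_poissonKernel_mul hw hu.continuousOn.circleIntegrable'
  have cic : CircleIntegrable (fun z => poissonKernel 0 w z * (Real.log lam - 1)) 0 1 :=
    circleIntegrable_poissonKernel_mul hw (circleIntegrable_const _ 0 1)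
  have cil : CircleIntegrable
      (fun z => lam⁻¹ * (poissonKernel 0 w z * (‖F.eval z‖ * Real.exp (-ψ z)))) 0 1 :=
    ciu.const_mul lam⁻¹
  have cis : CircleIntegrable
      (fun z => lam⁻¹ * (poissonKernel 0 w z * (‖F.eval z‖ * Real.exp (-ψ z))) +
        poissonKernel 0 w z * (Real.log lam - 1)) 0 1 := cil.add cic
  -- Concavity of the logarithm enters as `log s ≤ s - 1` with `s = ‖F‖ exp(-ψ) / lam`: the average
  -- of `s` is at most one and cancels the `-1`. The zeros of `F` meet the circle in a null set of
  -- angles.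
  have h2 : Real.circleAverage (fun z => poissonKernel 0 w z * G z) 0 1 ≤
      Real.circleAverage (fun z => poissonKernel 0 w z * ψ z +
        (lam⁻¹ * (poissonKernel 0 w z * (‖F.eval z‖ * Real.exp (-ψ z))) +
          poissonKernel 0 w z * (Real.log lam - 1))) 0 1 := by
    unfold Real.circleAverage
    refine smul_le_smul_of_nonneg_left ?_ (by positivity)
    refine intervalIntegral.integral_mono_ae (by positivity)
      (circleIntegrable_poissonKernel_mul hw hGi) (ciψ.add cis) ?_
    have hnull : {θ : ℝ | F.eval (circleMap 0 1 θ) = 0}.Countable := by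
      have : {θ : ℝ | F.eval (circleMap 0 1 θ) = 0} = circleMap 0 1 ⁻¹' {z | F.IsRoot z} := rfl
      rw [this]
      exact (Polynomial.finite_setOfPred_isRoot hF0).countable.preimage_circleMap 0 one_ne_zero
    filter_upwards [hnull.ae_notMem volume] with θ hθ
    set z := circleMap 0 1 θ
    have hz : F.eval z ≠ 0 := hθ
    have hK := poissonKernel_circleMap_nonneg hw θ
    have hGz : G z = Real.log ‖F.eval z‖ := (hlog z hz).symm
    have hpos : 0 < ‖F.eval z‖ * Real.exp (-ψ z) / lam := by
      have := norm_pos_iff.2 hz; positivity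
    have hle := Real.log_le_sub_one_of_pos hpos
    rw [Real.log_div (by have := norm_pos_iff.2 hz; positivity) hlam.ne',
      Real.log_mul (norm_ne_zero_iff.2 hz) (Real.exp_pos _).ne', Real.log_exp] at hle
    rw [hGz]
    calc _ ≤ poissonKernel 0 w z * (ψ z + ‖F.eval z‖ * Real.exp (-ψ z) / lam +
          (Real.log lam - 1)) := by
          apply mul_le_mul_of_nonneg_left _ hK; linarith
      _ = _ := by ring
  have e1 := Real.circleAverage_add ciψ cis
  have e2 := Real.circleAverage_add cil cic
  have e3 := Real.circleAverage_smul (a := lam⁻¹) (c := 0) (R := 1)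
    (f := fun z => poissonKernel 0 w z * (‖F.eval z‖ * Real.exp (-ψ z)))
  simp only [Pi.add_def, Pi.smul_def, smul_eq_mul] at e1 e2 e3
  rw [e1, e2, e3, circleAverage_poissonKernel_mul_const hw] at h2
  have h3 : lam⁻¹ * Real.circleAverage
      (fun z => poissonKernel 0 w z * (‖F.eval z‖ * Real.exp (-ψ z))) 0 1 ≤ 1 := by
    calc _ ≤ lam⁻¹ * lam := by gcongr
      _ = 1 := inv_mul_cancel₀ hlam.ne'
  linarith

/-! ### The Joukowsky map: from the circle to the interval `[-a, a]`. -/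

/-- Substituting `x = a cos θ` over a full period. -/
lemma integral_comp_cos_mul_abs_sin {h : ℝ → ℝ} (hh : Continuous h) (a : ℝ) :
    ∫ θ in (0 : ℝ)..2 * Real.pi, h (a * Real.cos θ) * (a * |Real.sin θ|) =
      2 * ∫ x in -a..a, h x := by
  have hd : ∀ θ : ℝ, HasDerivAt (fun θ => a * Real.cos θ) (a * -Real.sin θ) θ := fun θ =>
    (Real.hasDerivAt_cos θ).const_mul a
  have hint : ∀ b c : ℝ, IntervalIntegrable
      (fun θ => h (a * Real.cos θ) * (a * |Real.sin θ|)) volume b c := fun b c =>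
    Continuous.intervalIntegrable (by fun_prop) _ _
  rw [← intervalIntegral.integral_add_adjacent_intervals (hint 0 Real.pi) (hint _ _)]
  have h1 : ∫ θ in (0 : ℝ)..Real.pi, h (a * Real.cos θ) * (a * |Real.sin θ|) =
      ∫ x in -a..a, h x := by
    have := intervalIntegral.integral_comp_mul_deriv (a := 0) (b := Real.pi)
      (fun θ _ => hd θ) (by fun_prop) hh
    simp only [Real.cos_zero, Real.cos_pi, mul_one, mul_neg, Function.comp] at this
    rw [intervalIntegral.integral_symm a, ← this, ← intervalIntegral.integral_neg]
    refine intervalIntegral.integral_congr fun θ hθ => ?_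
    rw [uIcc_of_le Real.pi_pos.le] at hθ
    simp only [abs_of_nonneg (Real.sin_nonneg_of_mem_Icc hθ)]
    ring
  have h2 : ∫ θ in Real.pi..2 * Real.pi, h (a * Real.cos θ) * (a * |Real.sin θ|) =
      ∫ x in -a..a, h x := by
    have := intervalIntegral.integral_comp_mul_deriv (a := Real.pi) (b := 2 * Real.pi)
      (fun θ _ => hd θ) (by fun_prop) hh
    simp only [Real.cos_two_pi, Real.cos_pi, mul_one, mul_neg, Function.comp] at this
    rw [← this]
    refine intervalIntegral.integral_congr fun θ hθ => ?_
    rw [uIcc_of_le (by linarith [Real.pi_pos])] at hθ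
    have hs : Real.sin θ ≤ 0 := by
      have := Real.sin_nonneg_of_nonneg_of_le_pi (x := θ - Real.pi) (by linarith [hθ.1])
        (by linarith [hθ.2])
      rw [Real.sin_sub_pi] at this; linarith
    simp only [abs_of_nonpos hs]
    ring
  rw [h1, h2]; ring

/-- The polynomial `w ↦ w ^ n P (a (w + w⁻¹) / 2) (1 - w ^ 2)`. -/
def joukowsky (P : Polynomial ℂ) (n : ℕ) (a : ℝ) : Polynomial ℂ :=
  (∑ k ∈ Finset.range (n + 1), Polynomial.C (P.coeff k * (a / 2 : ℂ) ^ k) *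
    (Polynomial.X ^ 2 + 1) ^ k * Polynomial.X ^ (n - k)) * (1 - Polynomial.X ^ 2)

lemma eval_joukowsky {P : Polynomial ℂ} {n : ℕ} (hP : P.natDegree ≤ n) (a : ℝ) {w : ℂ}
    (hw : w ≠ 0) :
    (joukowsky P n a).eval w = w ^ n * P.eval (a * (w + w⁻¹) / 2) * (1 - w ^ 2) := by
  rw [joukowsky, Polynomial.eval_mul, Polynomial.eval_finsetSum,
    Polynomial.eval_eq_sum_range' (Nat.lt_succ_of_le hP), Finset.mul_sum]
  congr 1
  · refine Finset.sum_congr rfl fun k hk => ?_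
    have hk : k ≤ n := by simp at hk; omega
    obtain ⟨j, rfl⟩ := Nat.exists_eq_add_of_le hk
    have : (a * (w + w⁻¹) / 2 : ℂ) = a / 2 * ((w ^ 2 + 1) * w⁻¹) := by field_simp
    simp only [Polynomial.eval_mul, Polynomial.eval_C, Polynomial.eval_pow, Polynomial.eval_add,
      Polynomial.eval_X, Polynomial.eval_one, add_tsub_cancel_left]
    rw [this, mul_pow, mul_pow (w ^ 2 + 1), pow_add, inv_pow]
    field_simp
  · simp

/-- The preimage in the unit disc of the point `i` under the map `w ↦ a (w + w⁻¹) / 2` is `-r i`,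
where `r` is this number. -/
def joukowskyRadius (a : ℝ) : ℝ := Real.sqrt (1 + 1 / a ^ 2) - 1 / a

/-- This is the quadratic equation obtained by putting `w = -r i` into `a (w + w⁻¹) / 2 = i`; the
later facts about `r` rest on it. -/
lemma joukowskyRadius_sq {a : ℝ} : joukowskyRadius a ^ 2 = 1 - 2 * joukowskyRadius a / a := by
  have h := Real.sq_sqrt (show 0 ≤ 1 + 1 / a ^ 2 by positivity)
  rw [joukowskyRadius]
  have e : 1 / a ^ 2 = (1 / a) ^ 2 := by rw [div_pow, one_pow]
  rw [e] at h ⊢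
  have e2 : ∀ s : ℝ, 2 * (s - 1 / a) / a = 2 * (s - 1 / a) * (1 / a) := fun s => by ring
  rw [e2]
  nlinarith

lemma joukowskyRadius_pos (a : ℝ) : 0 < joukowskyRadius a := by
  rw [joukowskyRadius, sub_pos]
  apply Real.lt_sqrt_of_sq_lt
  rw [div_pow, one_pow]; linarith

lemma joukowskyRadius_lt_one {a : ℝ} (ha : 0 < a) : joukowskyRadius a < 1 := by
  have h1 := joukowskyRadius_sq (a := a)
  have h2 := joukowskyRadius_pos a
  have h3 : 0 < 2 * joukowskyRadius a / a := by positivity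
  nlinarith

lemma inv_joukowskyRadius (a : ℝ) :
    (joukowskyRadius a)⁻¹ = joukowskyRadius a + 2 / a := by
  have h1 := joukowskyRadius_sq (a := a)
  have h2 := joukowskyRadius_pos a
  refine inv_eq_of_mul_eq_one_right ?_
  rw [mul_add, ← sq, h1]; ring

lemma norm_joukowsky_point (a : ℝ) :
    ‖-(joukowskyRadius a : ℂ) * Complex.I‖ = joukowskyRadius a := by
  rw [norm_mul, norm_neg, Complex.norm_real, Complex.norm_I, mul_one, Real.norm_eq_abs,
    abs_of_pos (joukowskyRadius_pos a)]

/-- The value is `(-r i)^n (1 + r²)`, and `log r ≥ 1 - r⁻¹ ≥ -2/a`. This is where the degree costs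
`2n/a`. -/
lemma eval_joukowsky_point {P : Polynomial ℂ} {n : ℕ} (hP : P.natDegree ≤ n) {a : ℝ}
    (ha : 0 < a) (hPI : P.eval Complex.I = 1) :
    (joukowsky P n a).eval (-(joukowskyRadius a : ℂ) * Complex.I) ≠ 0 ∧ -(2 * (n / a)) ≤
      Real.log ‖(joukowsky P n a).eval (-(joukowskyRadius a : ℂ) * Complex.I)‖ := by
  have hr := joukowskyRadius_pos a
  have hr1 := joukowskyRadius_lt_one ha
  have hinv := inv_joukowskyRadius a
  set r := joukowskyRadius a
  have hrc : (r : ℂ) ≠ 0 := by exact_mod_cast hr.ne'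
  have hac : (a : ℂ) ≠ 0 := by exact_mod_cast ha.ne'
  have hw : -(r : ℂ) * Complex.I ≠ 0 := mul_ne_zero (neg_ne_zero.2 hrc) Complex.I_ne_zero
  have hpt : (a * (-(r : ℂ) * Complex.I + (-(r : ℂ) * Complex.I)⁻¹) / 2 : ℂ) = Complex.I := by
    have : (-(r : ℂ) * Complex.I)⁻¹ = ((r⁻¹ : ℝ) : ℂ) * Complex.I := by
      rw [mul_inv, Complex.inv_I, inv_neg]; push_cast; ring
    rw [this, hinv]; push_cast; field_simp; ring
  have hev : (joukowsky P n a).eval (-(r : ℂ) * Complex.I) =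
      (-(r : ℂ) * Complex.I) ^ n * ((1 + r ^ 2 : ℝ) : ℂ) := by
    rw [eval_joukowsky hP a hw, hpt, hPI, mul_one]
    congr 1
    rw [mul_pow, Complex.I_sq]; push_cast; ring
  have hn : ‖(joukowsky P n a).eval (-(r : ℂ) * Complex.I)‖ = r ^ n * (1 + r ^ 2) := by
    rw [hev, norm_mul, norm_pow, norm_joukowsky_point a, Complex.norm_real, Real.norm_eq_abs,
      abs_of_pos (by positivity)]
  refine ⟨norm_pos_iff.1 (by rw [hn]; positivity), ?_⟩
  rw [hn, Real.log_mul (by positivity) (by positivity), Real.log_pow]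
  have h1 : 0 ≤ Real.log (1 + r ^ 2) := Real.log_nonneg (by nlinarith)
  have h2 := Real.one_sub_inv_le_log_of_pos hr
  have h3 : -(2 / a) ≤ Real.log r := by linarith
  have h4 : (n : ℝ) * -(2 / a) ≤ n * Real.log r := by gcongr
  have : (n : ℝ) * -(2 / a) = -(2 * (n / a)) := by ring
  linarith

/-- With `x = a cos θ`, this compares the kernel with `a` times the half-plane kernel `1/(1 + x²)`.
The numerator is `1 - r² = 2r/a`; the denominator is estimated from `1 - r ≥ r/a` and `cos² θ ≤ 2 (1
+ sin θ)`. -/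
lemma poissonKernel_joukowsky_le {a : ℝ} (ha : 1 ≤ a) (θ : ℝ) :
    poissonKernel 0 (-(joukowskyRadius a : ℂ) * Complex.I) (circleMap 0 1 θ) ≤
      6 * (a / (1 + (a * Real.cos θ) ^ 2)) := by
  have ha0 : 0 < a := by linarith
  have hr := joukowskyRadius_pos a
  have hr1 := joukowskyRadius_lt_one ha0
  have hinv := inv_joukowskyRadius a
  have hsq := joukowskyRadius_sq (a := a)
  rw [poissonKernel_def]
  simp only [sub_zero, norm_circleMap_zero, abs_one, norm_joukowsky_point a]
  set r := joukowskyRadius a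
  have hden : ‖circleMap 0 1 θ - -(r : ℂ) * Complex.I‖ ^ 2 =
      (1 - r) ^ 2 + 2 * r * (1 + Real.sin θ) := by
    rw [← Complex.normSq_eq_norm_sq, Complex.normSq_apply]
    simp [circleMap, Complex.exp_ofReal_mul_I_re, Complex.exp_ofReal_mul_I_im]
    nlinarith [Real.sin_sq_add_cos_sq θ]
  have hr3 : 1 / 3 ≤ r := by
    have h2a : 2 / a ≤ 2 := by rw [div_le_iff₀ ha0]; linarith
    have : r⁻¹ ≤ 3 := by rw [hinv]; linarith
    rw [inv_le_comm₀ hr (by norm_num)] at this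
    linarith
  have h1r : r / a ≤ 1 - r := by
    have e : (1 - r) * (1 + r) = 2 * (r / a) := by
      have : 2 * r / a = 2 * (r / a) := by ring
      nlinarith
    have : 0 < r / a := by positivity
    nlinarith
  have hd : r ^ 2 / a ^ 2 + r * Real.cos θ ^ 2 ≤ (1 - r) ^ 2 + 2 * r * (1 + Real.sin θ) := by
    have h1 : r ^ 2 / a ^ 2 ≤ (1 - r) ^ 2 := by
      rw [← div_pow]; gcongr
    have h2 : Real.cos θ ^ 2 ≤ 2 * (1 + Real.sin θ) := by
      nlinarith [Real.sin_sq_add_cos_sq θ, Real.neg_one_le_sin θ, Real.sin_le_one θ]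
    nlinarith
  rw [hden, one_pow, show 1 - r ^ 2 = 2 * r / a by rw [hsq]; ring]
  have hd0 : 0 < r ^ 2 / a ^ 2 + r * Real.cos θ ^ 2 := by positivity
  calc 2 * r / a / ((1 - r) ^ 2 + 2 * r * (1 + Real.sin θ)) ≤
        2 * r / a / (r ^ 2 / a ^ 2 + r * Real.cos θ ^ 2) := by gcongr
    _ ≤ 6 * (a / (1 + (a * Real.cos θ) ^ 2)) := by
      rw [← mul_div_assoc, div_le_div_iff₀ hd0 (by positivity)]
      have e : 6 * a * (r ^ 2 / a ^ 2 + r * Real.cos θ ^ 2) =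
          6 * r ^ 2 / a + 6 * a * r * Real.cos θ ^ 2 := by field_simp
      have e2 : 2 * r / a * (1 + (a * Real.cos θ) ^ 2) =
          2 * r / a + 2 * a * r * Real.cos θ ^ 2 := by field_simp
      rw [e, e2]
      have h3 : 2 * r / a ≤ 6 * r ^ 2 / a := by
        refine div_le_div_of_nonneg_right ?_ ha0.le
        nlinarith
      have h4 : 0 ≤ a * r * Real.cos θ ^ 2 := by positivity
      nlinarith

/-- The factor `1 - w²` was put into `joukowsky` for the sake of the `|sin θ|` here, which is the
Jacobian of `x = a cos θ` up to the factor `a`. -/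
lemma norm_eval_joukowsky_circleMap {P : Polynomial ℂ} {n : ℕ} (hP : P.natDegree ≤ n) (a θ : ℝ) :
    ‖(joukowsky P n a).eval (circleMap 0 1 θ)‖ =
      ‖P.eval ((a * Real.cos θ : ℝ) : ℂ)‖ * (2 * |Real.sin θ|) := by
  set z := circleMap 0 1 θ with hz
  have hz1 : ‖z‖ = 1 := by simp [hz]
  have hz0 : z ≠ 0 := norm_pos_iff.1 (by rw [hz1]; exact one_pos)
  have hre : z.re = Real.cos θ := by simp [hz, circleMap, Complex.exp_ofReal_mul_I_re]
  have him : z.im = Real.sin θ := by simp [hz, circleMap, Complex.exp_ofReal_mul_I_im]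
  have hinv : z⁻¹ = (starRingEnd ℂ) z := by
    rw [Complex.inv_def, Complex.normSq_eq_norm_sq, hz1]; simp
  have h1 : (a * (z + z⁻¹) / 2 : ℂ) = ((a * Real.cos θ : ℝ) : ℂ) := by
    rw [hinv, Complex.add_conj, hre]; push_cast; ring
  have h2 : 1 - z ^ 2 = -z * ((2 * Real.sin θ : ℝ) * Complex.I) := by
    have := Complex.sub_conj z
    rw [him, ← hinv] at this
    rw [← this]; field_simp; ring
  rw [eval_joukowsky hP a hz0, h1, h2]
  simp only [norm_mul, norm_pow, norm_neg, hz1, Complex.norm_real, Complex.norm_I, one_pow,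
    Real.norm_eq_abs, abs_two, one_mul, mul_one]

lemma circleMap_re (θ : ℝ) : (circleMap 0 1 θ).re = Real.cos θ := by
  simp [circleMap, Complex.exp_ofReal_mul_I_re]

/-- Where `|sin θ| ≥ 1/2`, the Jacobian can be inserted at the cost of a factor two, which yields
the integral. Where `|sin θ| ≤ 1/2`, the point `a cos θ` is near an end of the interval, the kernel
is `O(1/a)`, and `ψ ≤ ψ a`. -/
lemma circleAverage_poissonKernel_joukowsky_le {a : ℝ} (ha : 1 ≤ a) {ψ : ℝ → ℝ}
    (hψ : Continuous ψ) (hψ0 : ∀ x, 0 ≤ ψ x) (hψm : ∀ x, |x| ≤ a → ψ x ≤ ψ a) :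
    Real.circleAverage
      (fun z => poissonKernel 0 (-(joukowskyRadius a : ℂ) * Complex.I) z * ψ (a * z.re)) 0 1 ≤
      4 * (∫ x in -a..a, ψ x / (1 + x ^ 2)) + 8 * (ψ a / a) := by
  have ha0 : 0 < a := by linarith
  have hw : ‖-(joukowskyRadius a : ℂ) * Complex.I‖ < 1 := by
    rw [norm_joukowsky_point a]; exact joukowskyRadius_lt_one ha0
  set h : ℝ → ℝ := fun x => ψ x / (1 + x ^ 2) with hh
  have hhc : Continuous h := hψ.div (by fun_prop) fun x => by positivity
  have hh0 : ∀ x, 0 ≤ h x := fun x => div_nonneg (hψ0 x) (by positivity)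
  have hpt : ∀ θ : ℝ, poissonKernel 0 (-(joukowskyRadius a : ℂ) * Complex.I) (circleMap 0 1 θ) *
      ψ (a * (circleMap 0 1 θ).re) ≤
      12 * (h (a * Real.cos θ) * (a * |Real.sin θ|)) + 8 * (ψ a / a) := by
    intro θ
    rw [circleMap_re]
    have h1 : poissonKernel 0 (-(joukowskyRadius a : ℂ) * Complex.I) (circleMap 0 1 θ) *
        ψ (a * Real.cos θ) ≤ 6 * (a / (1 + (a * Real.cos θ) ^ 2)) * ψ (a * Real.cos θ) :=
      mul_le_mul_of_nonneg_right (poissonKernel_joukowsky_le ha θ) (hψ0 _)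
    refine h1.trans ?_
    have hψa : 0 ≤ ψ a / a := div_nonneg (hψ0 a) ha0.le
    rcases le_total (1 / 2) |Real.sin θ| with hs | hs
    · have e : 6 * (a / (1 + (a * Real.cos θ) ^ 2)) * ψ (a * Real.cos θ) =
          12 * (h (a * Real.cos θ) * (a * (1 / 2))) := by
        simp only [hh]; ring
      have : h (a * Real.cos θ) * (a * (1 / 2)) ≤ h (a * Real.cos θ) * (a * |Real.sin θ|) :=
        mul_le_mul_of_nonneg_left (by gcongr) (hh0 _)
      linarith
    · have hc : 3 / 4 ≤ Real.cos θ ^ 2 := by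
        have : Real.sin θ ^ 2 ≤ 1 / 4 := by rw [← sq_abs]; nlinarith [abs_nonneg (Real.sin θ)]
        nlinarith [Real.sin_sq_add_cos_sq θ]
      have h2 : a / (1 + (a * Real.cos θ) ^ 2) ≤ 4 / 3 / a := by
        rw [div_le_div_iff₀ (by positivity) ha0]
        nlinarith [mul_pos ha0 ha0]
      have h3 : ψ (a * Real.cos θ) ≤ ψ a := hψm _ (by
        rw [abs_mul, abs_of_pos ha0]
        exact mul_le_of_le_one_right ha0.le (Real.abs_cos_le_one θ))
      have h4 : 0 ≤ h (a * Real.cos θ) * (a * |Real.sin θ|) :=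
        mul_nonneg (hh0 _) (by positivity)
      calc 6 * (a / (1 + (a * Real.cos θ) ^ 2)) * ψ (a * Real.cos θ) ≤
            6 * (4 / 3 / a) * ψ a := by
              have := hψ0 (a * Real.cos θ)
              gcongr
        _ = 8 * (ψ a / a) := by ring
        _ ≤ _ := by linarith
  unfold Real.circleAverage
  have hI := integral_comp_cos_mul_abs_sin hhc a
  have hle : ∫ θ in (0 : ℝ)..2 * Real.pi,
      poissonKernel 0 (-(joukowskyRadius a : ℂ) * Complex.I) (circleMap 0 1 θ) *
      ψ (a * (circleMap 0 1 θ).re) ≤ ∫ θ in (0 : ℝ)..2 * Real.pi,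
      (12 * (h (a * Real.cos θ) * (a * |Real.sin θ|)) + 8 * (ψ a / a)) := by
    refine intervalIntegral.integral_mono_on (by positivity)
      (Continuous.intervalIntegrable ?_ _ _) (Continuous.intervalIntegrable (by fun_prop) _ _)
      fun θ _ => hpt θ
    refine (continuous_poissonKernel_circleMap hw).mul ?_
    simp only [circleMap_re]
    fun_prop
  rw [intervalIntegral.integral_add (Continuous.intervalIntegrable (by fun_prop) _ _)
    (Continuous.intervalIntegrable (by fun_prop) _ _), intervalIntegral.integral_const_mul, hI,
    intervalIntegral.integral_const, smul_eq_mul] at hle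
  have hpi := Real.pi_pos
  have hpi3 := Real.pi_gt_three
  have hnn : 0 ≤ ∫ x in -a..a, h x :=
    intervalIntegral.integral_nonneg (by linarith) fun x _ => hh0 x
  have hle2 := mul_le_mul_of_nonneg_left hle (show 0 ≤ (2 * Real.pi)⁻¹ by positivity)
  rw [smul_eq_mul]
  refine hle2.trans ?_
  have e : (2 * Real.pi)⁻¹ * (12 * (2 * ∫ x in -a..a, h x) + (2 * Real.pi - 0) * (8 * (ψ a / a))) =
      12 / Real.pi * (∫ x in -a..a, h x) + 8 * (ψ a / a) := by
    field_simp; ring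
  rw [e]
  have : 12 / Real.pi ≤ 4 := by rw [div_le_iff₀ hpi]; linarith
  gcongr

/-- A polynomial that equals `1` at `i` cannot be small on `[-a, a]` in a weighted `L¹` norm. -/
lemma neg_le_log_of_integral_le {P : Polynomial ℂ} {n : ℕ} (hP : P.natDegree ≤ n)
    (hPI : P.eval Complex.I = 1) {a : ℝ} (ha : 1 ≤ a) {ψ : ℝ → ℝ} (hψ : Continuous ψ)
    (hψ0 : ∀ x, 0 ≤ ψ x) (hψm : ∀ x, |x| ≤ a → ψ x ≤ ψ a) {lam : ℝ} (hlam : 0 < lam)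
    (h : 4 * ∫ x in -a..a, ‖P.eval (x : ℂ)‖ * Real.exp (-ψ x) ≤ lam) :
    -(2 * (n / a) + 4 * (∫ x in -a..a, ψ x / (1 + x ^ 2)) + 8 * (ψ a / a)) ≤ Real.log lam := by
  have ha0 : 0 < a := by linarith
  have hw : ‖-(joukowskyRadius a : ℂ) * Complex.I‖ < 1 := by
    rw [norm_joukowsky_point a]; exact joukowskyRadius_lt_one ha0
  obtain ⟨hF, hlog⟩ := eval_joukowsky_point hP ha0 hPI
  have hψ' : Continuous fun z : ℂ => ψ (a * z.re) := by fun_prop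
  have key := log_norm_eval_le_of_circleAverage_le hw hF hψ' hlam ?_
  · have := circleAverage_poissonKernel_joukowsky_le ha hψ hψ0 hψm
    linarith
  refine le_trans ?_ h
  set g : ℝ → ℝ := fun x => ‖P.eval (x : ℂ)‖ * Real.exp (-ψ x) with hg
  have hgc : Continuous g := by fun_prop
  have hg0 : ∀ x, 0 ≤ g x := fun x => by positivity
  have hI := integral_comp_cos_mul_abs_sin hgc a
  have hle : ∫ θ in (0 : ℝ)..2 * Real.pi,
      poissonKernel 0 (-(joukowskyRadius a : ℂ) * Complex.I) (circleMap 0 1 θ) *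
        (‖(joukowsky P n a).eval (circleMap 0 1 θ)‖ *
          Real.exp (-ψ (a * (circleMap 0 1 θ).re))) ≤
      ∫ θ in (0 : ℝ)..2 * Real.pi, 12 * (g (a * Real.cos θ) * (a * |Real.sin θ|)) := by
    refine intervalIntegral.integral_mono_on (by positivity)
      (Continuous.intervalIntegrable ?_ _ _) (Continuous.intervalIntegrable (by fun_prop) _ _)
      fun θ _ => ?_
    · refine (continuous_poissonKernel_circleMap hw).mul ?_
      simp only [circleMap_re]
      have := (joukowsky P n a).continuous.comp (continuous_circleMap 0 1)
      exact this.norm.mul (by fun_prop)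
    · rw [circleMap_re, norm_eval_joukowsky_circleMap hP]
      -- The crude bound `6 a` suffices here: the `a` joins the `|sin θ|` from `joukowsky` to form
      -- the full Jacobian.
      have h6 : poissonKernel 0 (-(joukowskyRadius a : ℂ) * Complex.I) (circleMap 0 1 θ) ≤
          6 * a := (poissonKernel_joukowsky_le ha θ).trans (by
            have : a / (1 + (a * Real.cos θ) ^ 2) ≤ a :=
              div_le_self ha0.le (by nlinarith [sq_nonneg (a * Real.cos θ)])
            linarith)
      have h7 : 0 ≤ ‖P.eval ((a * Real.cos θ : ℝ) : ℂ)‖ * (2 * |Real.sin θ|) *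
          Real.exp (-ψ (a * Real.cos θ)) := by positivity
      refine (mul_le_mul_of_nonneg_right h6 h7).trans_eq ?_
      simp only [hg]; ring
  rw [intervalIntegral.integral_const_mul, hI] at hle
  have hpi := Real.pi_pos
  have hpi3 := Real.pi_gt_three
  have hnn : 0 ≤ ∫ x in -a..a, g x :=
    intervalIntegral.integral_nonneg (by linarith) fun x _ => hg0 x
  have hle2 := mul_le_mul_of_nonneg_left hle (show 0 ≤ (2 * Real.pi)⁻¹ by positivity)
  unfold Real.circleAverage
  rw [smul_eq_mul]
  refine hle2.trans ?_
  have e : (2 * Real.pi)⁻¹ * (12 * (2 * ∫ x in -a..a, g x)) =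
      12 / Real.pi * ∫ x in -a..a, g x := by field_simp
  rw [e]
  have : 12 / Real.pi ≤ 4 := by rw [div_le_iff₀ hpi]; linarith
  gcongr

/-! ### Weights, and the passage between `bestError` and polynomials normalised at `i`. -/

lemma intervalIntegral_comp_abs {f : ℝ → ℝ} (hf : Continuous fun x => f |x|) {a : ℝ}
    (ha : 0 ≤ a) : ∫ x in -a..a, f |x| = 2 * ∫ x in (0 : ℝ)..a, f x := by
  rw [← intervalIntegral.integral_add_adjacent_intervals (b := 0)
    (hf.intervalIntegrable _ _) (hf.intervalIntegrable _ _)]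
  have h1 : ∫ x in (0 : ℝ)..a, f |x| = ∫ x in (0 : ℝ)..a, f x := by
    refine intervalIntegral.integral_congr fun x hx => ?_
    rw [uIcc_of_le ha] at hx
    simp only [abs_of_nonneg hx.1]
  have h2 := intervalIntegral.integral_comp_neg (a := 0) (b := a) (fun x => f |x|)
  simp only [abs_neg, neg_zero] at h2
  rw [← h2, h1]; ring

namespace IsWeight

variable {φ : ℝ → ℝ}

lemma continuous_comp_abs (hφ : IsWeight φ) : Continuous fun x => φ |x| :=
  hφ.continuousOn.comp_continuous continuous_abs fun x => abs_nonneg x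

lemma continuous_weight (hφ : IsWeight φ) : Continuous (weight φ) :=
  Real.continuous_exp.comp hφ.continuous_comp_abs

/-- `W` dominates `(1 + x²)²` off a compact set, by superpolynomial growth with exponents 0, 2 and
4. This lets `φ` absorb polynomial factors and gives integrability. -/
lemma exists_two_mul_log_le (hφ : IsWeight φ) :
    ∃ C : ℝ, 0 ≤ C ∧ ∀ x : ℝ, 2 * Real.log (1 + x ^ 2) ≤ φ |x| + C := by
  have ht : Tendsto (fun t : ℝ => t ^ 0 / weight φ t + 2 * (t ^ 2 / weight φ t) +
      t ^ 4 / weight φ t) (cocompact ℝ) (𝓝 0) := by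
    simpa using ((hφ.superpolynomial 0).add ((hφ.superpolynomial 2).const_mul 2)).add
      (hφ.superpolynomial 4)
  obtain ⟨K, hK, hKs⟩ := mem_cocompact.1 (ht.eventually_lt_const zero_lt_one)
  have hW := hφ.continuous_weight
  obtain ⟨C, hC⟩ := hK.exists_bound_of_continuousOn
    (f := fun x : ℝ => 2 * Real.log (1 + x ^ 2) - φ |x|)
    (Continuous.continuousOn (by
      have h1 : Continuous fun x : ℝ => Real.log (1 + x ^ 2) :=
        Continuous.log (by fun_prop) fun x => by positivity
      exact (h1.const_mul 2).sub hφ.continuous_comp_abs))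
  refine ⟨max C 0, le_max_right _ _, fun x => ?_⟩
  by_cases hx : x ∈ K
  · have := (le_abs_self _).trans (hC x hx)
    linarith [le_max_left C 0]
  · have h1 : x ^ 0 / weight φ x + 2 * (x ^ 2 / weight φ x) + x ^ 4 / weight φ x < 1 := hKs hx
    have hWp : 0 < weight φ x := Real.exp_pos _
    have h2 : (1 + x ^ 2) ^ 2 / weight φ x < 1 := by
      calc _ = x ^ 0 / weight φ x + 2 * (x ^ 2 / weight φ x) + x ^ 4 / weight φ x := by ring
        _ < 1 := h1
    rw [div_lt_one hWp] at h2
    have h3 : Real.log ((1 + x ^ 2) ^ 2) ≤ φ |x| := by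
      rw [← Real.log_exp (φ |x|)]
      exact Real.log_le_log (by positivity) h2.le
    rw [Real.log_pow] at h3
    push_cast at h3
    linarith [le_max_right C 0]

/-- The bound is uniform in `p`: the function is at most one, so its `p`-th power is at most itself,
and `D ≥ 1` survives the `p`-th root. -/
lemma exists_eLpNorm_le (hφ : IsWeight φ) : ∃ D : ℝ, 1 ≤ D ∧ ∀ p : ℝ≥0∞, 1 ≤ p → p ≠ ∞ →
    eLpNorm (fun t : ℝ => Real.exp (-(φ |t| / 2))) p volume ≤ ENNReal.ofReal D := by
  obtain ⟨C, hC, hlog⟩ := hφ.exists_two_mul_log_le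
  have hle : ∀ t : ℝ, Real.exp (-(φ |t| / 2)) ≤ Real.exp (C / 2) * (1 + t ^ 2)⁻¹ := fun t => by
    rw [← Real.exp_log (show 0 < (1 + t ^ 2)⁻¹ by positivity), ← Real.exp_add, Real.log_inv]
    apply Real.exp_le_exp.2
    linarith [hlog t]
  have hint := integrable_inv_one_add_sq.const_mul (Real.exp (C / 2))
  set J := ∫ t : ℝ, Real.exp (C / 2) * (1 + t ^ 2)⁻¹ with hJ
  refine ⟨max 1 J, le_max_left _ _, fun p hp hp' => ?_⟩
  have hp1 : 1 ≤ p.toReal := by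
    rw [← ENNReal.toReal_one]; exact ENNReal.toReal_mono hp' hp
  rw [eLpNorm_eq_lintegral_rpow_enorm_toReal (zero_lt_one.trans_le hp).ne' hp']
  have h1 : ∫⁻ t : ℝ, ‖Real.exp (-(φ |t| / 2))‖ₑ ^ p.toReal ≤ ENNReal.ofReal (max 1 J) := by
    calc _ ≤ ∫⁻ t : ℝ, ENNReal.ofReal (Real.exp (C / 2) * (1 + t ^ 2)⁻¹) := by
          refine lintegral_mono fun t => ?_
          have h0 := Real.exp_pos (-(φ |t| / 2))
          have h2 : Real.exp (-(φ |t| / 2)) ≤ 1 := by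
            rw [Real.exp_le_one_iff]
            linarith [hφ.nonneg |t| (abs_nonneg t)]
          rw [Real.enorm_of_nonneg h0.le]
          have h3 : ENNReal.ofReal (Real.exp (-(φ |t| / 2))) ≤ 1 := by
            rw [← ENNReal.ofReal_one]; exact ENNReal.ofReal_le_ofReal h2
          calc _ ≤ ENNReal.ofReal (Real.exp (-(φ |t| / 2))) ^ (1 : ℝ) :=
                ENNReal.rpow_le_rpow_of_exponent_ge h3 hp1
            _ ≤ _ := by rw [ENNReal.rpow_one]; exact ENNReal.ofReal_le_ofReal (hle t)
      _ = ENNReal.ofReal J :=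
          (ofReal_integral_eq_lintegral_ofReal hint (ae_of_all _ fun t => by positivity)).symm
      _ ≤ _ := ENNReal.ofReal_le_ofReal (le_max_right _ _)
  have hD1 : 1 ≤ ENNReal.ofReal (max 1 J) := by
    rw [← ENNReal.ofReal_one]; exact ENNReal.ofReal_le_ofReal (le_max_left _ _)
  calc _ ≤ ENNReal.ofReal (max 1 J) ^ (1 / p.toReal) :=
        ENNReal.rpow_le_rpow h1 (by positivity)
    _ ≤ ENNReal.ofReal (max 1 J) ^ (1 : ℝ) :=
        ENNReal.rpow_le_rpow_of_exponent_le hD1 (by rw [div_le_one (by linarith)]; exact hp1)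
    _ = _ := ENNReal.rpow_one _

/-- A polynomial `P` of degree at most `n` with small values relative to `|P (i)|` yields an
approximation of the Cauchy kernel. -/
lemma exists_iInf_le (hφ : IsWeight φ) : ∃ D : ℝ, 1 ≤ D ∧ ∀ (n : ℕ) (P : Polynomial ℂ) (B : ℝ),
    P.natDegree ≤ n → P.eval Complex.I ≠ 0 → 0 ≤ B →
    (∀ x : ℝ, ‖P.eval (x : ℂ)‖ ≤ B * Real.exp (φ |x| / 2)) → ∀ p : ℝ≥0∞, 1 ≤ p →
    ⨅ Q ∈ Polynomial.degreeLT ℂ n, weightedNorm p (weight φ)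
      (fun x : ℝ => 1 / ((x : ℂ) - Complex.I) - Q.eval (x : ℂ)) ≤
      ENNReal.ofReal (D * (B / ‖P.eval Complex.I‖)) := by
  obtain ⟨D, hD, hDp⟩ := hφ.exists_eLpNorm_le
  refine ⟨D, hD, fun n P B hP hPI hB hbd p hp => ?_⟩
  set R := P /ₘ (Polynomial.X - Polynomial.C Complex.I) with hR
  have hdiv : Polynomial.C (P.eval Complex.I) + (Polynomial.X - Polynomial.C Complex.I) * R = P := by
    have := Polynomial.modByMonic_add_div P (Polynomial.X - Polynomial.C Complex.I)
    rwa [Polynomial.modByMonic_X_sub_C_eq_C_eval] at this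
  have hP0 : P ≠ 0 := by rintro rfl; simp at hPI
  have hRd : R.degree < n := by
    calc R.degree < P.degree := Polynomial.degree_divByMonic_lt P _ hP0
          (by rw [Polynomial.degree_X_sub_C]; exact zero_lt_one)
      _ ≤ n := Polynomial.natDegree_le_iff_degree_le.1 hP
  -- With this choice `1/(x - i) - Q = P / ((x - i) P(i))`.
  set Q := Polynomial.C (-(P.eval Complex.I)⁻¹) * R with hQ
  have hQd : Q ∈ Polynomial.degreeLT ℂ n := by
    rw [Polynomial.mem_degreeLT, hQ, Polynomial.degree_C_mul (by simpa using hPI)]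
    exact hRd
  refine (iInf₂_le Q hQd).trans ?_
  have hx : ∀ x : ℝ, (x : ℂ) - Complex.I ≠ 0 := fun x h => by
    have := congrArg Complex.im h; simp at this
  have hxn : ∀ x : ℝ, 1 ≤ ‖(x : ℂ) - Complex.I‖ := fun x => by
    have := Complex.abs_im_le_norm ((x : ℂ) - Complex.I)
    simpa using this
  have hval : ∀ x : ℝ, 1 / ((x : ℂ) - Complex.I) - Q.eval (x : ℂ) =
      P.eval (x : ℂ) / (((x : ℂ) - Complex.I) * P.eval Complex.I) := fun x => by
    have h1 : P.eval (x : ℂ) = P.eval Complex.I + ((x : ℂ) - Complex.I) * R.eval (x : ℂ) := by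
      conv_lhs => rw [← hdiv]
      simp
    have h2 := hx x
    rw [h1, hQ]
    simp only [Polynomial.eval_mul, Polynomial.eval_C]
    field_simp
    ring
  have hnorm : ∀ x : ℝ, ‖(1 / ((x : ℂ) - Complex.I) - Q.eval (x : ℂ)) / (weight φ x : ℂ)‖ ≤
      B / ‖P.eval Complex.I‖ * Real.exp (-(φ |x| / 2)) := fun x => by
    have hPp : 0 < ‖P.eval Complex.I‖ := norm_pos_iff.2 hPI
    rw [hval, norm_div, norm_div, norm_mul, Complex.norm_real, Real.norm_eq_abs,
      abs_of_pos (show 0 < weight φ x from Real.exp_pos _), weight]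
    -- One half of `φ` absorbs the growth of `P`; the other half provides the finite `L^p` norm.
    have e : Real.exp (φ |x|) = Real.exp (φ |x| / 2) * Real.exp (φ |x| / 2) := by
      rw [← Real.exp_add]; congr 1; ring
    rw [Real.exp_neg, e]
    have hE := Real.exp_pos (φ |x| / 2)
    calc _ ≤ B * Real.exp (φ |x| / 2) / (1 * ‖P.eval Complex.I‖) /
          (Real.exp (φ |x| / 2) * Real.exp (φ |x| / 2)) := by
          gcongr
          · exact hbd x
          · exact hxn x
      _ = _ := by field_simp
  have hB' : 0 ≤ B / ‖P.eval Complex.I‖ := by positivity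
  rw [weightedNorm]
  split_ifs with hpt
  · refine iSup_le fun x => ?_
    rw [← ofReal_norm]
    refine ENNReal.ofReal_le_ofReal ((hnorm x).trans ?_)
    have h1 : Real.exp (-(φ |x| / 2)) ≤ 1 := by
      rw [Real.exp_le_one_iff]; linarith [hφ.nonneg |x| (abs_nonneg x)]
    rw [mul_comm D]
    gcongr
    linarith
  · calc _ ≤ eLpNorm (fun t : ℝ => B / ‖P.eval Complex.I‖ * Real.exp (-(φ |t| / 2))) p volume :=
          eLpNorm_mono_real hnorm
      _ ≤ ‖B / ‖P.eval Complex.I‖‖ₑ *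
          eLpNorm (fun t : ℝ => Real.exp (-(φ |t| / 2))) p volume :=
          eLpNorm_const_smul_le (c := B / ‖P.eval Complex.I‖)
            (f := fun t : ℝ => Real.exp (-(φ |t| / 2)))
      _ ≤ ENNReal.ofReal (B / ‖P.eval Complex.I‖) * ENNReal.ofReal D := by
          rw [Real.enorm_of_nonneg hB']
          gcongr
          exact hDp p hp hpt
      _ = _ := by rw [← ENNReal.ofReal_mul hB', mul_comm]

/-- Hölder with respect to `dx/(1 + x²)`, a measure below Lebesgue measure with total mass `π ≤ 4`.
It reduces every `p` to a weighted `L¹` bound with one constant. -/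
lemma lintegral_enorm_mul_inv_le {f : ℝ → ℂ} (hf : Continuous f) {p : ℝ≥0∞} (hp : 1 ≤ p) :
    ∫⁻ t : ℝ, ‖f t‖ₑ * ENNReal.ofReal (1 + t ^ 2)⁻¹ ≤ 4 * eLpNorm f p volume := by
  set s : ℝ → ℝ≥0∞ := fun t => ENNReal.ofReal (1 + t ^ 2)⁻¹ with hs
  have hsm : Measurable s := by
    refine ENNReal.measurable_ofReal.comp (Continuous.measurable ?_)
    exact Continuous.inv₀ (by fun_prop) fun t => by positivity
  set ν := (volume : Measure ℝ).withDensity s with hν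
  have hνle : ν ≤ volume := by
    calc ν ≤ volume.withDensity 1 := withDensity_mono (ae_of_all _ fun t => by
          simp only [hs, Pi.one_apply]
          rw [← ENNReal.ofReal_one]
          refine ENNReal.ofReal_le_ofReal (inv_le_one_of_one_le₀ ?_)
          nlinarith [sq_nonneg t])
      _ = volume := withDensity_one
  have hνu : ν univ ≤ 4 := by
    rw [hν, withDensity_apply _ MeasurableSet.univ, Measure.restrict_univ,
      ← ofReal_integral_eq_lintegral_ofReal integrable_inv_one_add_sq
        (ae_of_all _ fun t => by positivity), integral_univ_inv_one_add_sq]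
    calc ENNReal.ofReal Real.pi ≤ ENNReal.ofReal 4 := ENNReal.ofReal_le_ofReal Real.pi_le_four
      _ = 4 := by norm_num
  have h1 := eLpNorm_le_eLpNorm_mul_rpow_measure_univ (μ := ν) hp hf.aestronglyMeasurable
  rw [eLpNorm_one_eq_lintegral_enorm, hν,
    lintegral_withDensity_eq_lintegral_mul _ hsm hf.enorm.measurable, ← hν] at h1
  calc _ = ∫⁻ t : ℝ, (s * fun t => ‖f t‖ₑ) t := by
        refine lintegral_congr fun t => ?_
        simp only [Pi.mul_apply, hs]; ring
    _ ≤ _ := h1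
    _ ≤ eLpNorm f p volume * 4 := by
        refine mul_le_mul' (eLpNorm_mono_measure f hνle) ?_
        have he0 : 0 ≤ 1 / (1 : ℝ≥0∞).toReal - 1 / p.toReal := by
          rcases eq_or_ne p ∞ with rfl | hpt
          · simp
          · have hp1 : 1 ≤ p.toReal := by
              rw [← ENNReal.toReal_one]; exact ENNReal.toReal_mono hpt hp
            rw [ENNReal.toReal_one, sub_nonneg, div_le_div_iff₀ (by linarith) one_pos]; linarith
        have he1 : 1 / (1 : ℝ≥0∞).toReal - 1 / p.toReal ≤ 1 := by
          rw [ENNReal.toReal_one]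
          have : 0 ≤ 1 / p.toReal := by positivity
          linarith
        calc _ ≤ (4 : ℝ≥0∞) ^ (1 / (1 : ℝ≥0∞).toReal - 1 / p.toReal) :=
              ENNReal.rpow_le_rpow hνu he0
          _ ≤ (4 : ℝ≥0∞) ^ (1 : ℝ) := ENNReal.rpow_le_rpow_of_exponent_le (by norm_num) he1
          _ = 4 := ENNReal.rpow_one _
    _ = _ := mul_comm _ _

lemma eLpNorm_le_weightedNorm (W : ℝ → ℝ) (f : ℝ → ℂ) (p : ℝ≥0∞) :
    eLpNorm (fun t : ℝ => f t / (W t : ℂ)) p volume ≤ weightedNorm p W f := by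
  rw [weightedNorm]
  split_ifs with hp
  · rw [hp, eLpNorm_exponent_top]
    exact eLpNormEssSup_le_of_ae_enorm_bound
      (ae_of_all _ fun t => le_iSup (fun t : ℝ => ‖f t / (W t : ℂ)‖ₑ) t)
  · exact le_rfl

/-- `neg_le_log_of_integral_le` is applied to `P = 1 - (x - i) Q`. The term `2 log (1 + x²)` added
to `φ` in `ψ` pays for `|x - i| ≤ 1 + x²` and for the density `1/(1 + x²)` of the Hölder step; by
`exists_two_mul_log_le` it costs at most another `φ` and a constant. -/
lemma exists_neg_le_log_of_weightedNorm_le (hφ : IsWeight φ) :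
    ∃ C : ℝ, ∀ (n : ℕ) (a : ℝ), 1 ≤ a → ∀ p : ℝ≥0∞, 1 ≤ p → ∀ Q ∈ Polynomial.degreeLT ℂ n,
    ∀ N : ℝ, 0 < N → weightedNorm p (weight φ)
      (fun x : ℝ => 1 / ((x : ℂ) - Complex.I) - Q.eval (x : ℂ)) ≤ ENNReal.ofReal N →
    -(2 * (n / a) + 16 * (∫ x in (0 : ℝ)..a, φ x / (x ^ 2 + 1)) + 16 * (φ a / a) + C) ≤
      Real.log N := by
  obtain ⟨C, hC, hlog⟩ := hφ.exists_two_mul_log_le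
  refine ⟨16 * C + 8 * C + Real.log 16, fun n a ha p hp Q hQ N hN hle => ?_⟩
  have ha0 : 0 < a := by linarith
  set P : Polynomial ℂ := 1 - (Polynomial.X - Polynomial.C Complex.I) * Q with hPdef
  have hPI : P.eval Complex.I = 1 := by simp [hPdef]
  have hPd : P.natDegree ≤ n := by
    rcases eq_or_ne Q 0 with h0 | h0
    · simp [hPdef, h0]
    · have hQn : Q.natDegree < n := by
        rw [Polynomial.natDegree_lt_iff_degree_lt h0]; exact Polynomial.mem_degreeLT.1 hQ
      refine (Polynomial.natDegree_sub_le _ _).trans (max_le (by simp) ?_)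
      refine Polynomial.natDegree_mul_le.trans ?_
      rw [Polynomial.natDegree_X_sub_C]; omega
  have hx : ∀ x : ℝ, (x : ℂ) - Complex.I ≠ 0 := fun x h => by
    have := congrArg Complex.im h; simp at this
  have hxn : ∀ x : ℝ, ‖(x : ℂ) - Complex.I‖ ≤ 1 + x ^ 2 := fun x => by
    have h1 : ‖(x : ℂ) - Complex.I‖ ^ 2 = 1 + x ^ 2 := by
      rw [← Complex.normSq_eq_norm_sq, Complex.normSq_apply]; simp; ring
    nlinarith [norm_nonneg ((x : ℂ) - Complex.I), sq_nonneg x]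
  set f : ℝ → ℂ := fun t =>
    (1 / ((t : ℂ) - Complex.I) - Q.eval (t : ℂ)) / (weight φ t : ℂ) with hf
  have hfc : Continuous f := by
    refine Continuous.div ?_ (Complex.continuous_ofReal.comp hφ.continuous_weight)
      fun t => by exact_mod_cast (Real.exp_pos _).ne'
    exact (Continuous.div (by fun_prop) (by fun_prop) hx).sub (by fun_prop)
  have hPf : ∀ x : ℝ, P.eval (x : ℂ) = ((x : ℂ) - Complex.I) * (weight φ x : ℂ) * f x := fun x => by
    have h1 : (weight φ x : ℂ) ≠ 0 := by exact_mod_cast (Real.exp_pos _).ne'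
    have h2 := hx x
    simp only [hf, hPdef, Polynomial.eval_sub, Polynomial.eval_one, Polynomial.eval_mul,
      Polynomial.eval_X, Polynomial.eval_C]
    field_simp
  set ψ : ℝ → ℝ := fun x => φ |x| + 2 * Real.log (1 + x ^ 2) with hψ
  have hlog0 : ∀ x : ℝ, 0 ≤ Real.log (1 + x ^ 2) := fun x =>
    Real.log_nonneg (by nlinarith [sq_nonneg x])
  have hlogc : Continuous fun x : ℝ => Real.log (1 + x ^ 2) :=
    Continuous.log (by fun_prop) fun x => by positivity
  have hψc : Continuous ψ := hφ.continuous_comp_abs.add (hlogc.const_mul 2)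
  have hψ0 : ∀ x, 0 ≤ ψ x := fun x => by
    have := hφ.nonneg |x| (abs_nonneg x)
    have := hlog0 x
    simp only [hψ]; linarith
  have hψm : ∀ x, |x| ≤ a → ψ x ≤ ψ a := fun x hxa => by
    have h1 : φ |x| ≤ φ |a| := hφ.strictMonoOn.monotoneOn (abs_nonneg x) (abs_nonneg a)
      (by rwa [abs_of_pos ha0])
    have h2 : Real.log (1 + x ^ 2) ≤ Real.log (1 + a ^ 2) := by
      refine Real.log_le_log (by positivity) ?_
      rw [← sq_abs x]; gcongr
    simp only [hψ]; linarith
  have hPψ : ∀ x : ℝ, ‖P.eval (x : ℂ)‖ * Real.exp (-ψ x) ≤ ‖f x‖ * (1 + x ^ 2)⁻¹ := fun x => by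
    have hq : 0 < 1 + x ^ 2 := by positivity
    have e : Real.exp (-ψ x) = (weight φ x)⁻¹ * ((1 + x ^ 2) ^ 2)⁻¹ := by
      simp only [hψ]
      rw [Real.exp_neg, Real.exp_add, mul_inv, weight, two_mul, Real.exp_add, Real.exp_log hq,
        sq (1 + x ^ 2)]
    have hW : 0 < weight φ x := Real.exp_pos _
    rw [hPf, norm_mul, norm_mul, e, Complex.norm_real, Real.norm_eq_abs, abs_of_pos hW]
    calc _ ≤ (1 + x ^ 2) * weight φ x * ‖f x‖ * ((weight φ x)⁻¹ * ((1 + x ^ 2) ^ 2)⁻¹) := by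
          gcongr; exact hxn x
      _ = _ := by field_simp
  have hint : 4 * ∫ x in -a..a, ‖P.eval (x : ℂ)‖ * Real.exp (-ψ x) ≤ 16 * N := by
    have hle2 : eLpNorm f p volume ≤ ENNReal.ofReal N :=
      (eLpNorm_le_weightedNorm _ _ p).trans hle
    have hgc : Continuous fun x : ℝ => ‖P.eval (x : ℂ)‖ * Real.exp (-ψ x) := by fun_prop
    have h1 : ENNReal.ofReal (∫ x in -a..a, ‖P.eval (x : ℂ)‖ * Real.exp (-ψ x)) ≤
        ENNReal.ofReal (4 * N) := by
      rw [intervalIntegral.integral_of_le (by linarith),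
        ofReal_integral_eq_lintegral_ofReal (hgc.integrableOn_Ioc)
          (ae_of_all _ fun x => by positivity)]
      calc _ ≤ ∫⁻ x : ℝ, ENNReal.ofReal (‖P.eval (x : ℂ)‖ * Real.exp (-ψ x)) :=
            setLIntegral_le_lintegral _ _
        _ ≤ ∫⁻ x : ℝ, ‖f x‖ₑ * ENNReal.ofReal (1 + x ^ 2)⁻¹ := by
            refine lintegral_mono fun x => ?_
            rw [← ofReal_norm, ← ENNReal.ofReal_mul (norm_nonneg _)]
            exact ENNReal.ofReal_le_ofReal (hPψ x)
        _ ≤ 4 * eLpNorm f p volume := lintegral_enorm_mul_inv_le hfc hp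
        _ ≤ 4 * ENNReal.ofReal N := by gcongr
        _ = ENNReal.ofReal (4 * N) := by rw [ENNReal.ofReal_mul (by norm_num)]; norm_num
    rw [ENNReal.ofReal_le_ofReal_iff (by linarith)] at h1
    linarith
  have key := neg_le_log_of_integral_le hPd hPI ha hψc hψ0 hψm (by linarith) hint
  rw [Real.log_mul (by norm_num) hN.ne'] at key
  have hψle : ∀ x, ψ x ≤ 2 * φ |x| + C := fun x => by
    have := hlog x
    simp only [hψ]; linarith
  have hcφ : Continuous fun x : ℝ => φ |x| / (|x| ^ 2 + 1) :=
    hφ.continuous_comp_abs.div (by fun_prop) fun x => by positivity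
  have hI : ∫ x in -a..a, ψ x / (1 + x ^ 2) ≤
      4 * (∫ x in (0 : ℝ)..a, φ x / (x ^ 2 + 1)) + 4 * C := by
    have hcC : Continuous fun x : ℝ => C * (1 + x ^ 2)⁻¹ :=
      continuous_const.mul (Continuous.inv₀ (by fun_prop) fun x => by positivity)
    have h1 : ∫ x in -a..a, ψ x / (1 + x ^ 2) ≤
        ∫ x in -a..a, (2 * (φ |x| / (|x| ^ 2 + 1)) + C * (1 + x ^ 2)⁻¹) := by
      refine intervalIntegral.integral_mono_on (by linarith)
        (Continuous.intervalIntegrable ?_ _ _) (Continuous.intervalIntegrable ?_ _ _)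
        fun x _ => ?_
      · exact hψc.div (by fun_prop) fun x => by positivity
      · exact (hcφ.const_mul 2).add hcC
      · rw [sq_abs, add_comm (x ^ 2) 1]
        calc _ ≤ (2 * φ |x| + C) / (1 + x ^ 2) := by gcongr; exact hψle x
          _ = _ := by ring
    rw [intervalIntegral.integral_add ((hcφ.const_mul 2).intervalIntegrable _ _)
      (hcC.intervalIntegrable _ _), intervalIntegral.integral_const_mul,
      intervalIntegral.integral_const_mul, integral_inv_one_add_sq,
      intervalIntegral_comp_abs (f := fun x => φ x / (x ^ 2 + 1)) hcφ ha0.le] at h1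
    have h2 : Real.arctan a - Real.arctan (-a) ≤ 4 := by
      rw [Real.arctan_neg]
      have := Real.arctan_lt_pi_div_two a
      linarith [Real.pi_le_four]
    have h3 := mul_le_mul_of_nonneg_left h2 hC
    linarith
  have ha2 : ψ a / a ≤ 2 * (φ a / a) + C := by
    have h1 := hψle a
    rw [abs_of_pos ha0] at h1
    have h2 : C / a ≤ C := div_le_self hC ha
    calc ψ a / a ≤ (2 * φ a + C) / a := by gcongr
      _ = 2 * (φ a / a) + C / a := by ring
      _ ≤ _ := by linarith
  linarith

/-- The lower estimate of the approximation error, valid for all weights. -/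
lemma exists_exp_le_bestError (hφ : IsWeight φ) :
    ∃ C : ℝ, ∀ (n : ℕ) (a : ℝ), 1 ≤ a → ∀ p : ℝ≥0∞, 1 ≤ p →
    Real.exp (-(2 * (n / a) + 16 * (∫ x in (0 : ℝ)..a, φ x / (x ^ 2 + 1)) + 16 * (φ a / a) + C)) ≤
      bestError n p (weight φ) := by
  obtain ⟨C, hC⟩ := hφ.exists_neg_le_log_of_weightedNorm_le
  obtain ⟨D, hD, hDP⟩ := hφ.exists_iInf_le
  refine ⟨C, fun n a ha p hp => ?_⟩
  set T := -(2 * (n / a) + 16 * (∫ x in (0 : ℝ)..a, φ x / (x ^ 2 + 1)) + 16 * (φ a / a) + C)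
    with hT
  -- The test polynomial `1` shows that the infimum is finite; otherwise `toReal` would turn `∞`
  -- into `0`.
  have htop := (hDP n 1 1 (by simp) (by simp) zero_le_one (fun x => by
    have : 1 ≤ Real.exp (φ |x| / 2) :=
      Real.one_le_exp (by linarith [hφ.nonneg |x| (abs_nonneg x)])
    simpa using this) p hp).trans_lt ENNReal.ofReal_lt_top
  rw [bestError]
  refine (ENNReal.ofReal_le_iff_le_toReal htop.ne).1 (le_iInf₂ fun Q hQ => ?_)
  by_contra! hlt
  set N := weightedNorm p (weight φ) (fun x : ℝ => 1 / ((x : ℂ) - Complex.I) - Q.eval (x : ℂ))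
  have hNt : N ≠ ∞ := (hlt.trans ENNReal.ofReal_lt_top).ne
  have hNe : N.toReal < Real.exp T := by
    rwa [ENNReal.lt_ofReal_iff_toReal_lt hNt] at hlt
  -- The norm could a priori vanish, while `hC` needs a positive bound; the midpoint is positive and
  -- still below `exp T`.
  have hpos : 0 < (N.toReal + Real.exp T) / 2 := by
    have := Real.exp_pos T
    have : 0 ≤ N.toReal := ENNReal.toReal_nonneg
    linarith
  have h := hC n a ha p hp Q hQ _ hpos (by
    exact (ENNReal.le_ofReal_iff_toReal_le hNt hpos.le).2 (by linarith))
  rw [← hT, Real.le_log_iff_exp_le hpos] at h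
  linarith

/-- The upper estimate of the approximation error by means of a test polynomial. -/
lemma exists_bestError_le (hφ : IsWeight φ) : ∃ D : ℝ, 1 ≤ D ∧
    ∀ (n : ℕ) (P : Polynomial ℂ) (B : ℝ), P.natDegree ≤ n → P.eval Complex.I ≠ 0 → 0 ≤ B →
    (∀ x : ℝ, ‖P.eval (x : ℂ)‖ ≤ B * Real.exp (φ |x| / 2)) → ∀ p : ℝ≥0∞, 1 ≤ p →
    bestError n p (weight φ) ≤ D * (B / ‖P.eval Complex.I‖) := by
  obtain ⟨D, hD, hDP⟩ := hφ.exists_iInf_le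
  exact ⟨D, hD, fun n P B hP hPI hB hbd p hp =>
    ENNReal.toReal_le_of_le_ofReal (by positivity) (hDP n P B hP hPI hB hbd p hp)⟩

end IsWeight

/-! ### The inverse of `φ`, the divergent integral, and rapidly growing weights. -/

namespace IsWeight

variable {φ : ℝ → ℝ}

lemma exists_le_apply (hφ : IsWeight φ) (M : ℝ) : ∃ x : ℝ, 0 ≤ x ∧ M ≤ φ x := by
  obtain ⟨C, hC, hlog⟩ := hφ.exists_two_mul_log_le
  refine ⟨Real.exp (max 0 (M + C)), (Real.exp_pos _).le, ?_⟩
  have h := hlog (Real.exp (max 0 (M + C)))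
  rw [abs_of_pos (Real.exp_pos _)] at h
  have h2 : Real.log (Real.exp (max 0 (M + C)) ^ 2) ≤
      Real.log (1 + Real.exp (max 0 (M + C)) ^ 2) :=
    Real.log_le_log (by positivity) (by linarith)
  rw [Real.log_pow, Real.log_exp] at h2
  push_cast at h2
  linarith [le_max_left 0 (M + C), le_max_right 0 (M + C)]

lemma inverse_spec (hφ : IsWeight φ) {y : ℝ} (hy : φ 0 ≤ y) :
    0 ≤ inverse φ y ∧ φ (inverse φ y) = y := by
  have h : ∃ a ∈ Ici (0 : ℝ), φ a = y := by
    obtain ⟨b, hb, hyb⟩ := hφ.exists_le_apply y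
    obtain ⟨a, ha, hay⟩ := intermediate_value_Icc hb
      (hφ.continuousOn.mono Icc_subset_Ici_self) ⟨hy, hyb⟩
    exact ⟨a, ha.1, hay⟩
  exact ⟨Function.invFunOn_mem h, Function.invFunOn_eq h⟩

lemma tendsto_inverse (hφ : IsWeight φ) : Tendsto (inverse φ) atTop atTop := by
  refine tendsto_atTop.2 fun b => ?_
  have h0 : (0 : ℝ) ∈ Ici (0 : ℝ) := self_mem_Ici
  filter_upwards [eventually_ge_atTop (φ (max b 0)), eventually_ge_atTop (φ 0)] with y hy hy0
  obtain ⟨h1, h2⟩ := hφ.inverse_spec hy0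
  by_contra! hlt
  have := hφ.strictMonoOn h1 (mem_Ici.2 (le_max_right b 0)) (hlt.trans_le (le_max_left b 0))
  linarith

lemma eventually_inverse (hφ : IsWeight φ) (b : ℝ) :
    ∀ᶠ n : ℕ in atTop, b ≤ inverse φ n ∧ φ (inverse φ n) = n := by
  filter_upwards [(hφ.tendsto_inverse.comp tendsto_natCast_atTop_atTop).eventually_ge_atTop b,
    (tendsto_natCast_atTop_atTop (R := ℝ)).eventually_ge_atTop (φ 0)] with n h1 h2
  exact ⟨h1, (hφ.inverse_spec h2).2⟩

lemma continuousOn_div (hφ : IsWeight φ) :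
    ContinuousOn (fun x => φ x / (x ^ 2 + 1)) (Ici 0) :=
  hφ.continuousOn.div (by fun_prop) fun x _ => by positivity

lemma intervalIntegrable_div (hφ : IsWeight φ) {a b : ℝ} (ha : 0 ≤ a) (hb : 0 ≤ b) :
    IntervalIntegrable (fun x => φ x / (x ^ 2 + 1)) volume a b :=
  (hφ.continuousOn_div.mono fun _ hx => (le_min ha hb).trans hx.1).intervalIntegrable

lemma integral_div_add (hφ : IsWeight φ) {a b : ℝ} (ha : 0 ≤ a) (hb : 0 ≤ b) :
    (∫ x in (0 : ℝ)..a, φ x / (x ^ 2 + 1)) + ∫ x in a..b, φ x / (x ^ 2 + 1) =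
      ∫ x in (0 : ℝ)..b, φ x / (x ^ 2 + 1) :=
  intervalIntegral.integral_add_adjacent_intervals (hφ.intervalIntegrable_div le_rfl ha)
    (hφ.intervalIntegrable_div ha hb)

lemma integral_div_nonneg (hφ : IsWeight φ) {a b : ℝ} (ha : 0 ≤ a) (hab : a ≤ b) :
    0 ≤ ∫ x in a..b, φ x / (x ^ 2 + 1) :=
  intervalIntegral.integral_nonneg hab fun x hx =>
    div_nonneg (hφ.nonneg x (ha.trans hx.1)) (by positivity)

lemma integral_div_mono (hφ : IsWeight φ) {a b : ℝ} (ha : 0 ≤ a) (hab : a ≤ b) :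
    ∫ x in (0 : ℝ)..a, φ x / (x ^ 2 + 1) ≤ ∫ x in (0 : ℝ)..b, φ x / (x ^ 2 + 1) := by
  rw [← hφ.integral_div_add ha (ha.trans hab)]
  linarith [hφ.integral_div_nonneg ha hab]

/-- Divergence of the logarithmic integral enters here: bounded partial integrals would make the
nonnegative integrand integrable. It later allows additive constants to be absorbed into the
integral. -/
lemma exists_le_integral_div (hφ : IsWeight φ) (M : ℝ) :
    ∃ b : ℝ, 0 ≤ b ∧ ∀ a, b ≤ a → M ≤ ∫ x in (0 : ℝ)..a, φ x / (x ^ 2 + 1) := by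
  suffices h : ∃ b : ℝ, 0 ≤ b ∧ M ≤ ∫ x in (0 : ℝ)..b, φ x / (x ^ 2 + 1) by
    obtain ⟨b, hb, hM⟩ := h
    exact ⟨b, hb, fun a hab => hM.trans (hφ.integral_div_mono hb hab)⟩
  by_contra! hcon
  have hc : Continuous fun x : ℝ => φ |x| / (|x| ^ 2 + 1) :=
    hφ.continuous_comp_abs.div (by fun_prop) fun x => by positivity
  have hnn : ∀ x : ℝ, 0 ≤ φ |x| / (|x| ^ 2 + 1) := fun x =>
    div_nonneg (hφ.nonneg _ (abs_nonneg x)) (by positivity)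
  have hint : Integrable fun x : ℝ => φ |x| / (|x| ^ 2 + 1) := by
    refine integrable_of_intervalIntegral_norm_bounded (2 * M) (a := fun t : ℝ => -t)
      (b := fun t : ℝ => t) (l := atTop) (fun t => hc.integrableOn_Ioc) tendsto_neg_atTop_atBot
      tendsto_id ?_
    filter_upwards [eventually_ge_atTop 0] with t ht
    simp only [Real.norm_eq_abs, abs_of_nonneg (hnn _)]
    rw [intervalIntegral_comp_abs (f := fun x => φ x / (x ^ 2 + 1)) hc ht]
    linarith [hcon t ht]
  have h1 := ofReal_integral_eq_lintegral_ofReal hint (ae_of_all _ hnn)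
  have h2 := hφ.log_integral_eq_top
  have h3 : ∫⁻ t : ℝ, ENNReal.ofReal (Real.log (weight φ t) / (1 + t ^ 2)) =
      ∫⁻ t : ℝ, ENNReal.ofReal (φ |t| / (|t| ^ 2 + 1)) := by
    refine lintegral_congr fun t => ?_
    rw [weight, Real.log_exp, sq_abs, add_comm]
  rw [h3, ← h1] at h2
  exact ENNReal.ofReal_ne_top h2

lemma eventually_le_integral_div (hφ : IsWeight φ) (M : ℝ) :
    ∀ᶠ n : ℕ in atTop, M ≤ ∫ x in (0 : ℝ)..inverse φ n, φ x / (x ^ 2 + 1) := by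
  obtain ⟨b, _, hM⟩ := hφ.exists_le_integral_div M
  filter_upwards [hφ.eventually_inverse b] with n hn
  exact hM _ hn.1

/-- The two-sided estimate for rapidly growing weights. -/
theorem rapidlyGrowing_estimate (hφ : IsWeight φ) (h : RapidlyGrowing φ) :
    ∃ c C : ℝ, 0 < c ∧ 0 < C ∧ ∀ᶠ n : ℕ in atTop, ∀ p : ℝ≥0∞, 1 ≤ p →
      -C * (n / inverse φ n) ≤ Real.log (bestError n p (weight φ)) ∧
        Real.log (bestError n p (weight φ)) ≤ -c * (n / inverse φ n) := by
  obtain ⟨ε, A, hε, hA, hmono⟩ := h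
  obtain ⟨C, hC⟩ := hφ.exists_exp_le_bestError
  obtain ⟨D, hD, hup⟩ := hφ.exists_bestError_le
  set IA := ∫ x in (0 : ℝ)..A, φ x / (x ^ 2 + 1) with hIA
  have hφA : 0 < φ A := (hφ.nonneg 0 le_rfl).trans_lt
    (hφ.strictMonoOn self_mem_Ici (mem_Ici.2 hA.le) hA)
  set κ := φ A / A ^ (1 + ε) with hκ
  have hκ0 : 0 < κ := by positivity
  -- Rapid growth gives `n / a ≥ κ a^ε` at `a = φ⁻¹(n)`, so `n / a` absorbs additive constants.
  have hlarge : Tendsto (fun n : ℕ => (n : ℝ) / inverse φ n) atTop atTop := by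
    have h1 : Tendsto (fun n : ℕ => κ * inverse φ n ^ ε) atTop atTop :=
      ((tendsto_rpow_atTop hε).comp
        (hφ.tendsto_inverse.comp tendsto_natCast_atTop_atTop)).const_mul_atTop hκ0
    refine tendsto_atTop_mono' _ ?_ h1
    filter_upwards [hφ.eventually_inverse A] with n hn
    have ha : 0 < inverse φ n := hA.trans_le hn.1
    have h2 := hmono self_mem_Ici (mem_Ici.2 hn.1) hn.1
    simp only [hn.2] at h2
    calc κ * inverse φ n ^ ε ≤ n / inverse φ n ^ (1 + ε) * inverse φ n ^ ε := by gcongr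
      _ = n / inverse φ n := by
        rw [Real.rpow_add ha, Real.rpow_one]
        have := Real.rpow_pos_of_pos ha ε
        field_simp
  -- Here `18 = 2 + 16` comes from `n/a` and `φ(a)/a = n/a`, and `16/ε` from the integral. The test
  -- polynomial gives `1/18`, half of which is spent on the constant `log D + 1`.
  refine ⟨1 / 36, 18 + 16 / ε + |16 * IA + C|, by norm_num, by positivity, ?_⟩
  filter_upwards [hφ.eventually_inverse (max A 1), hlarge.eventually_ge_atTop 1,
    hlarge.eventually_ge_atTop (36 * (Real.log D + 1)), eventually_ge_atTop 2]
    with n ⟨ha, hφa⟩ hn1 hn2 hn p hp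
  set a := inverse φ n with hadef
  have haA : A ≤ a := (le_max_left _ _).trans ha
  have ha1 : 1 ≤ a := (le_max_right _ _).trans ha
  have ha0 : 0 < a := by linarith
  have hn0 : (0 : ℝ) < n := by positivity
  have hlow := hC n a ha1 p hp
  have hE : 0 < bestError n p (weight φ) := (Real.exp_pos _).trans_le hlow
  constructor
  · have hI : ∫ x in (0 : ℝ)..a, φ x / (x ^ 2 + 1) ≤ IA + 1 / ε * (n / a) := by
      rw [← hφ.integral_div_add hA.le ha0.le]
      gcongr
      have h1 : ∫ x in A..a, φ x / (x ^ 2 + 1) ≤ ∫ x in A..a, n / a ^ (1 + ε) * x ^ (ε - 1) := by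
        refine intervalIntegral.integral_mono_on haA (hφ.intervalIntegrable_div hA.le ha0.le)
          ((intervalIntegral.intervalIntegrable_rpow' (by linarith)).const_mul _) fun x hx => ?_
        have hx0 : 0 < x := hA.trans_le hx.1
        have h2 := hmono (mem_Ici.2 hx.1) (mem_Ici.2 haA) hx.2
        simp only [hφa] at h2
        have h3 : 0 ≤ φ x / x ^ (1 + ε) :=
          div_nonneg (hφ.nonneg x hx0.le) (by positivity)
        calc φ x / (x ^ 2 + 1) ≤ φ x / x ^ 2 := by
              gcongr
              · exact hφ.nonneg x hx0.le
              · linarith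
          _ = φ x / x ^ (1 + ε) * x ^ (ε - 1) := by
              rw [div_mul_eq_mul_div, div_eq_div_iff (by positivity) (by positivity), mul_assoc,
                ← Real.rpow_natCast, ← Real.rpow_add hx0]
              congr 2; push_cast; ring
          _ ≤ _ := by gcongr
      refine h1.trans ?_
      rw [intervalIntegral.integral_const_mul, integral_rpow (Or.inl (by linarith)),
        sub_add_cancel]
      have h4 : 0 < A ^ ε := by positivity
      calc n / a ^ (1 + ε) * ((a ^ ε - A ^ ε) / ε) ≤ n / a ^ (1 + ε) * (a ^ ε / ε) := by
            gcongr; linarith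
        _ = 1 / ε * (n / a) := by
            rw [Real.rpow_add ha0, Real.rpow_one]
            have := Real.rpow_pos_of_pos ha0 ε
            field_simp
    rw [Real.le_log_iff_exp_le hE]
    refine le_trans (Real.exp_le_exp.2 ?_) hlow
    rw [hφa, neg_mul, neg_le_neg_iff]
    have h5 : 16 * IA + C ≤ |16 * IA + C| * (n / a) :=
      (le_abs_self _).trans (le_mul_of_one_le_right (abs_nonneg _) hn1)
    have e : (18 + 16 / ε + |16 * IA + C|) * (n / a) =
        2 * (n / a) + 16 * (1 / ε * (n / a)) + 16 * (n / a) + |16 * IA + C| * (n / a) := by ring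
    rw [e]; linarith
  -- With half the degree, beyond `a` the exponent `m log (2|x|/a)` is at most `(n/2)(|x|/a) ≤
  -- φ(|x|)/2`. Integer division still leaves `m ≥ n/3` because `n ≥ 2`.
  · set m := n / 2 with hm
    have hm1 : (m : ℝ) ≤ n / 2 := Nat.cast_div_le
    have hm2 : (n : ℝ) / 3 ≤ m := by
      have : n ≤ 3 * m := by omega
      have : (n : ℝ) ≤ 3 * m := by exact_mod_cast this
      linarith
    have hPI := exp_le_norm_eval_expTrunc_I m ha1
    have hPI0 : 0 < ‖(expTrunc m a).eval Complex.I‖ := (Real.exp_pos _).trans_le hPI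
    have hbd := hup n (expTrunc m a) (Real.exp 1)
      ((natDegree_expTrunc_le m a).trans (Nat.div_le_self n 2)) (norm_pos_iff.1 hPI0)
      (Real.exp_pos 1).le (fun x => by
        have hx0 := hφ.nonneg |x| (abs_nonneg x)
        rw [← Real.exp_add]
        rcases le_total |x| a with hxa | hxa
        · refine (norm_eval_expTrunc_le_of_abs_le m ha0 hxa).trans (Real.exp_le_exp.2 ?_)
          have : (x / a) ^ 2 ≤ 1 := by
            rw [div_pow, div_le_one (by positivity), ← sq_abs x]; gcongr
          linarith
        · refine (norm_eval_expTrunc_le_of_le_abs m ha0 hxa).trans (Real.exp_le_exp.2 ?_)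
          have hxp : 0 < |x| := ha0.trans_le hxa
          have hy1 : 1 ≤ |x| / a := (one_le_div ha0).2 hxa
          have h1 : Real.log (2 * |x| / a) ≤ |x| / a := by
            rw [mul_div_assoc, Real.log_mul two_ne_zero (by positivity)]
            have := Real.log_le_sub_one_of_pos (show 0 < |x| / a by positivity)
            have := Real.log_two_lt_d9
            linarith
          have h2 := hmono (mem_Ici.2 haA) (mem_Ici.2 (haA.trans hxa)) hxa
          simp only [hφa] at h2
          have h3 : n * (|x| / a) ≤ φ |x| := by
            rw [div_le_div_iff₀ (by positivity) (by positivity)] at h2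
            have h4 : |x| / a ≤ (|x| / a) ^ (1 + ε) := Real.self_le_rpow_of_one_le hy1 (by linarith)
            calc n * (|x| / a) ≤ n * (|x| / a) ^ (1 + ε) := by gcongr
              _ = n * |x| ^ (1 + ε) / a ^ (1 + ε) := by
                rw [Real.div_rpow hxp.le ha0.le, mul_div_assoc]
              _ ≤ φ |x| := by rw [div_le_iff₀ (by positivity)]; exact h2
          calc (m : ℝ) * Real.log (2 * |x| / a) ≤ m * (|x| / a) := by gcongr
            _ ≤ n / 2 * (|x| / a) := by gcongr
            _ ≤ 1 + φ |x| / 2 := by linarith) p hp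
    have h1 : bestError n p (weight φ) ≤ Real.exp (Real.log D + (1 - m / (6 * a))) := by
      rw [Real.exp_add, Real.exp_log (by linarith), Real.exp_sub]
      refine hbd.trans ?_
      gcongr
    have h2 := (Real.log_le_iff_le_exp hE).2 h1
    have h3 : 1 / 18 * (n / a) ≤ m / (6 * a) := by
      calc 1 / 18 * (n / a) = n / 3 / (6 * a) := by field_simp; norm_num
        _ ≤ _ := by gcongr
    linarith

end IsWeight

/-! ### Dyadic products and normally growing weights. -/

/-- The increments of a sequence of natural numbers. -/
def increment (M : ℕ → ℕ) : ℕ → ℕ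
  | 0 => M 0
  | k + 1 => M (k + 1) - M k

/-- Summation by parts. It serves with `l = 1` for the degree, with `l` the reciprocal scales for
the value at `i`, and with `l` a positive part of a logarithm for the growth on the line. -/
lemma sum_increment_mul {M : ℕ → ℕ} (hM : Monotone M) (l : ℕ → ℝ) (K : ℕ) :
    ∑ k ∈ Finset.range (K + 1), (increment M k : ℝ) * l k =
      ∑ k ∈ Finset.range K, (M k : ℝ) * (l k - l (k + 1)) + M K * l K := by
  induction K with
  | zero => simp [increment]
  | succ K ih =>
    rw [Finset.sum_range_succ, ih, Finset.sum_range_succ, increment,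
      Nat.cast_sub (hM (Nat.le_succ K))]
    ring

lemma sum_increment {M : ℕ → ℕ} (hM : Monotone M) (K : ℕ) :
    ∑ k ∈ Finset.range (K + 1), increment M k = M K := by
  have := sum_increment_mul hM (fun _ => 1) K
  simp only [mul_one, sub_self, mul_zero, Finset.sum_const_zero, zero_add] at this
  exact_mod_cast this

/-- The product of the polynomials `expTrunc` at the scales `T * 2 ^ k`. -/
def dyadicProduct (M : ℕ → ℕ) (T : ℝ) (K : ℕ) : Polynomial ℂ :=
  ∏ k ∈ Finset.range (K + 1), expTrunc (increment M k) (T * 2 ^ k)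

lemma natDegree_dyadicProduct_le {M : ℕ → ℕ} (hM : Monotone M) (T : ℝ) (K : ℕ) :
    (dyadicProduct M T K).natDegree ≤ M K := by
  rw [← sum_increment hM K]
  exact (Polynomial.natDegree_prod_le _ _).trans
    (Finset.sum_le_sum fun k _ => natDegree_expTrunc_le _ _)

lemma sum_sq_div_le {T y : ℝ} (hT : 0 < T) (hy : 0 ≤ y) (N : ℕ) :
    ∑ k ∈ Finset.range N, (if y ≤ T * 2 ^ k then (y / (T * 2 ^ k)) ^ 2 else 0) ≤ 4 / 3 := by
  -- The extra term reserves room for the remaining geometric tail of ratio `1/4`, whose total is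
  -- `4/3`.
  suffices h : ∑ k ∈ Finset.range N, (if y ≤ T * 2 ^ k then (y / (T * 2 ^ k)) ^ 2 else 0) +
      4 / 3 * min 1 ((y / (T * 2 ^ N)) ^ 2) ≤ 4 / 3 by
    have : 0 ≤ min 1 ((y / (T * 2 ^ N)) ^ 2) := by positivity
    linarith
  induction N with
  | zero =>
    simp only [Finset.range_zero, Finset.sum_empty]
    linarith [min_le_left 1 ((y / (T * 2 ^ 0)) ^ 2)]
  | succ N ih =>
    rw [Finset.sum_range_succ]
    have hpos : 0 < T * 2 ^ N := by positivity
    split_ifs with h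
    · have h1 : (y / (T * 2 ^ N)) ^ 2 ≤ 1 := by
        rw [sq_le_one_iff₀ (by positivity), div_le_one hpos]; exact h
      rw [min_eq_right h1] at ih
      have h2 : (y / (T * 2 ^ (N + 1))) ^ 2 = (y / (T * 2 ^ N)) ^ 2 / 4 := by
        rw [show T * 2 ^ (N + 1) = 2 * (T * 2 ^ N) by ring]; ring
      have h3 := min_le_right 1 ((y / (T * 2 ^ (N + 1))) ^ 2)
      rw [h2] at h3 ⊢
      linarith
    · have h1 : 1 ≤ (y / (T * 2 ^ N)) ^ 2 := by
        apply one_le_pow₀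
        rw [one_le_div hpos]; exact (not_le.1 h).le
      rw [min_eq_left h1] at ih
      linarith [min_le_left 1 ((y / (T * 2 ^ (N + 1))) ^ 2)]

lemma norm_eval_dyadicProduct_le (M : ℕ → ℕ) {T : ℝ} (hT : 0 < T) (K : ℕ) (x : ℝ) :
    ‖(dyadicProduct M T K).eval (x : ℂ)‖ ≤ Real.exp (4 / 3 + ∑ k ∈ Finset.range (K + 1),
      (increment M k : ℝ) * max 0 (Real.log (2 * |x| / (T * 2 ^ k)))) := by
  rw [dyadicProduct, Polynomial.eval_prod, norm_prod]
  have h1 := sum_sq_div_le hT (abs_nonneg x) (K + 1)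
  calc _ ≤ ∏ k ∈ Finset.range (K + 1), Real.exp
        ((if |x| ≤ T * 2 ^ k then (|x| / (T * 2 ^ k)) ^ 2 else 0) +
          (increment M k : ℝ) * max 0 (Real.log (2 * |x| / (T * 2 ^ k)))) := by
        refine Finset.prod_le_prod (fun _ _ => norm_nonneg _) fun k _ => ?_
        have hpos : 0 < T * 2 ^ k := by positivity
        split_ifs with h
        · refine (norm_eval_expTrunc_le_of_abs_le _ hpos h).trans (Real.exp_le_exp.2 ?_)
          rw [div_pow, div_pow, sq_abs]
          exact le_add_of_nonneg_right (by positivity)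
        · refine (norm_eval_expTrunc_le_of_le_abs _ hpos (not_le.1 h).le).trans
            (Real.exp_le_exp.2 ?_)
          rw [zero_add]
          gcongr
          exact le_max_right _ _
    _ = Real.exp (∑ k ∈ Finset.range (K + 1),
          (if |x| ≤ T * 2 ^ k then (|x| / (T * 2 ^ k)) ^ 2 else 0) +
        ∑ k ∈ Finset.range (K + 1),
          (increment M k : ℝ) * max 0 (Real.log (2 * |x| / (T * 2 ^ k)))) := by
        rw [← Real.exp_sum, Finset.sum_add_distrib]
    _ ≤ _ := by gcongr

/-- By parts, the weights `1/t_k - 1/t_{k+1}` equal `1/(2 t_k)` at dyadic scales; this halves the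
`1/6` of the single factors. -/
lemma exp_le_norm_eval_dyadicProduct_I {M : ℕ → ℕ} (hM : Monotone M) {T : ℝ} (hT : 1 ≤ T)
    (K : ℕ) : Real.exp (1 / 12 * ∑ k ∈ Finset.range (K + 1), (M k : ℝ) / (T * 2 ^ k)) ≤
      ‖(dyadicProduct M T K).eval Complex.I‖ := by
  have hT0 : 0 < T := by linarith
  have h1 : 1 / 2 * ∑ k ∈ Finset.range (K + 1), (M k : ℝ) / (T * 2 ^ k) ≤
      ∑ k ∈ Finset.range (K + 1), (increment M k : ℝ) * (1 / (T * 2 ^ k)) := by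
    rw [sum_increment_mul hM, Finset.sum_range_succ, mul_add, Finset.mul_sum]
    refine add_le_add (Finset.sum_le_sum fun k _ => le_of_eq ?_) ?_
    · rw [pow_succ]; field_simp; norm_num
    · have : 0 ≤ (M K : ℝ) / (T * 2 ^ K) := by positivity
      rw [mul_one_div]; linarith
  rw [dyadicProduct, Polynomial.eval_prod, norm_prod]
  calc _ ≤ Real.exp (∑ k ∈ Finset.range (K + 1), (increment M k : ℝ) / (6 * (T * 2 ^ k))) := by
        apply Real.exp_le_exp.2
        have e : ∑ k ∈ Finset.range (K + 1), (increment M k : ℝ) / (6 * (T * 2 ^ k)) =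
            1 / 6 * ∑ k ∈ Finset.range (K + 1), (increment M k : ℝ) * (1 / (T * 2 ^ k)) := by
          rw [Finset.mul_sum]
          exact Finset.sum_congr rfl fun k _ => by field_simp
        rw [e]; linarith
    _ = ∏ k ∈ Finset.range (K + 1), Real.exp ((increment M k : ℝ) / (6 * (T * 2 ^ k))) :=
        Real.exp_sum _ _
    _ ≤ _ := Finset.prod_le_prod (fun _ _ => (Real.exp_pos _).le) fun k _ =>
        exp_le_norm_eval_expTrunc_I _ (one_le_mul_of_one_le_of_one_le hT
          (one_le_pow₀ one_le_two))

namespace IsWeight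

variable {φ : ℝ → ℝ} {A : ℝ}

lemma apply_two_mul_le (hA : 0 < A) (hanti : AntitoneOn (fun x => φ x / x ^ 2) (Ici A))
    {x : ℝ} (hx : A ≤ x) : φ (2 * x) ≤ 4 * φ x := by
  have hx0 : 0 < x := hA.trans_le hx
  have h := hanti (mem_Ici.2 hx) (mem_Ici.2 (show A ≤ 2 * x by linarith))
    (show x ≤ 2 * x by linarith)
  simp only at h
  rw [div_le_div_iff₀ (by positivity) (by positivity)] at h
  have : 0 < x ^ 2 := by positivity
  nlinarith

lemma two_mul_apply_le (hA : 0 < A)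
    (hconv : ConvexOn ℝ (Ici (Real.log A)) (fun t => φ (Real.exp t))) {x : ℝ} (hx : A ≤ x) :
    2 * φ (2 * x) ≤ φ x + φ (2 * (2 * x)) := by
  have hx0 : 0 < x := hA.trans_le hx
  have h1 : Real.log A ≤ Real.log x := Real.log_le_log hA hx
  have h2 : Real.log x ≤ Real.log (2 * (2 * x)) := Real.log_le_log hx0 (by linarith)
  have h := hconv.2 (mem_Ici.2 h1) (mem_Ici.2 (h1.trans h2))
    (show (0 : ℝ) ≤ 1 / 2 by norm_num) (show (0 : ℝ) ≤ 1 / 2 by norm_num) (by norm_num)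
  have e : (1 / 2 : ℝ) • Real.log x + (1 / 2 : ℝ) • Real.log (2 * (2 * x)) =
      Real.log (2 * x) := by
    rw [Real.log_mul two_ne_zero (by positivity), Real.log_mul two_ne_zero hx0.ne']
    simp only [smul_eq_mul]; ring
  rw [e] at h
  beta_reduce at h
  rw [Real.exp_log (by positivity), Real.exp_log hx0, Real.exp_log (by positivity)] at h
  simp only [smul_eq_mul] at h
  linarith

/-- The degrees of the partial products that approximate a normally growing weight. -/
def dyadicDegree (φ : ℝ → ℝ) (T : ℝ) (k : ℕ) : ℕ :=
  ⌊(φ (T * 2 ^ (k + 1)) - φ (T * 2 ^ k)) / 32⌋₊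

/-- Convexity in `log x` makes the dyadic differences of `φ` nondecreasing, so the truncated
subtractions in `increment` are true differences. -/
lemma monotone_dyadicDegree (hA : 0 < A)
    (hconv : ConvexOn ℝ (Ici (Real.log A)) (fun t => φ (Real.exp t))) {T : ℝ} (hT : A ≤ T) :
    Monotone (dyadicDegree φ T) := by
  refine monotone_nat_of_le_succ fun k => Nat.floor_mono ?_
  have h1 : A ≤ T * 2 ^ k := hT.trans (le_mul_of_one_le_right (by linarith)
    (one_le_pow₀ one_le_two))
  have h2 := two_mul_apply_le hA hconv h1
  rw [show 2 * (T * 2 ^ k) = T * 2 ^ (k + 1) by ring,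
    show 2 * (T * 2 ^ (k + 1)) = T * 2 ^ (k + 1 + 1) by ring] at h2
  linarith

/-- By parts, each degree is multiplied by the drop of the logarithm over one scale. This drop is at
most `log 2 ≤ 1` while the scale is below `2y` and zero afterwards, so the differences of `φ`
telescope to at most `φ(4y)/32`. Two doublings cost `16`, whence the `32` in `dyadicDegree`. -/
lemma sum_dyadicDegree_mul_le (hφ : IsWeight φ) (hA : 0 < A)
    (hanti : AntitoneOn (fun x => φ x / x ^ 2) (Ici A))
    (hconv : ConvexOn ℝ (Ici (Real.log A)) (fun t => φ (Real.exp t))) {T : ℝ} (hT : 2 * A ≤ T)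
    {y : ℝ} (hy : 0 ≤ y) (K : ℕ) :
    ∑ k ∈ Finset.range (K + 1), (increment (dyadicDegree φ T) k : ℝ) *
      max 0 (Real.log (2 * y / (T * 2 ^ k))) ≤ φ y / 2 := by
  have hT0 : 0 < T := by linarith
  have hmono := monotone_dyadicDegree hA hconv (show A ≤ T by linarith)
  set M := dyadicDegree φ T with hM
  set l : ℕ → ℝ := fun k => max 0 (Real.log (2 * y / (T * 2 ^ k))) with hl
  have hl0 : ∀ k, 0 ≤ l k := fun k => le_max_left _ _
  have hlz : ∀ k, 2 * y ≤ T * 2 ^ k → l k = 0 := fun k hk => by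
    refine max_eq_left (Real.log_nonpos (by positivity) ?_)
    exact (div_le_one (by positivity)).2 hk
  -- Doubling is available only from `A` on. Below `A` every logarithm vanishes, because `2y < 2A ≤
  -- T`.
  rcases lt_or_ge y A with hyA | hyA
  · have : ∀ k, l k = 0 := fun k => hlz k (by
      have : T ≤ T * 2 ^ k := le_mul_of_one_le_right hT0.le (one_le_pow₀ one_le_two)
      linarith)
    refine (Finset.sum_eq_zero fun k _ => mul_eq_zero_of_right _ (this k)).trans_le ?_
    linarith [hφ.nonneg y hy]
  have hy0 : 0 < y := hA.trans_le hyA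
  have hφm : ∀ {u v : ℝ}, 0 ≤ u → u ≤ v → φ u ≤ φ v := fun hu huv =>
    hφ.strictMonoOn.monotoneOn hu (hu.trans huv) huv
  -- The cap `4y` freezes the right side after the last contributing scale: if `T 2^N < 2y`, then `T
  -- 2^(N+1) < 4y`.
  have hstep : ∀ N : ℕ, ∑ k ∈ Finset.range N, (M k : ℝ) * (l k - l (k + 1)) ≤
      1 / 32 * (φ (min (T * 2 ^ N) (4 * y)) - φ (min (T * 2 ^ 0) (4 * y))) := by
    intro N
    induction N with
    | zero => simp
    | succ N ih =>
      rw [Finset.sum_range_succ]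
      have hT' : T * 2 ^ (N + 1) = 2 * (T * 2 ^ N) := by ring
      have hpos : 0 < T * 2 ^ N := by positivity
      rcases lt_or_ge (T * 2 ^ N) (2 * y) with h | h
      · have h1 : l N - l (N + 1) ≤ 1 := by
          have e : Real.log (2 * y / (T * 2 ^ (N + 1))) =
              Real.log (2 * y / (T * 2 ^ N)) - Real.log 2 := by
            rw [hT', ← Real.log_div (by positivity) (by norm_num)]
            congr 1; field_simp
          have h2 : l N = Real.log (2 * y / (T * 2 ^ N)) :=
            max_eq_right (Real.log_nonneg ((one_le_div hpos).2 h.le))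
          have h3 : Real.log (2 * y / (T * 2 ^ (N + 1))) ≤ l (N + 1) := le_max_right _ _
          have := Real.log_two_lt_d9
          linarith
        have hS : 0 ≤ φ (T * 2 ^ (N + 1)) - φ (T * 2 ^ N) :=
          sub_nonneg.2 (hφm hpos.le (by linarith))
        have h4 : (M N : ℝ) ≤ (φ (T * 2 ^ (N + 1)) - φ (T * 2 ^ N)) / 32 :=
          Nat.floor_le (by positivity)
        have h5 : (M N : ℝ) * (l N - l (N + 1)) ≤ M N := by
          have : (0 : ℝ) ≤ M N := Nat.cast_nonneg _
          nlinarith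
        rw [min_eq_left (show T * 2 ^ N ≤ 4 * y by linarith)] at ih
        rw [min_eq_left (show T * 2 ^ (N + 1) ≤ 4 * y by linarith)]
        linarith
      · have h1 : l N - l (N + 1) ≤ 0 := by rw [hlz N h]; linarith [hl0 (N + 1)]
        have h2 : (M N : ℝ) * (l N - l (N + 1)) ≤ 0 :=
          mul_nonpos_of_nonneg_of_nonpos (Nat.cast_nonneg _) h1
        have h3 : φ (min (T * 2 ^ N) (4 * y)) ≤ φ (min (T * 2 ^ (N + 1)) (4 * y)) :=
          hφm (le_min hpos.le (by linarith)) (min_le_min_right _ (by linarith))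
        linarith
  -- Extending the sum to a scale beyond `2y` only adds nonnegative terms and makes the boundary
  -- term of the summation by parts vanish.
  obtain ⟨N, hKN, hN⟩ : ∃ N : ℕ, K ≤ N ∧ 2 * y ≤ T * 2 ^ N := by
    obtain ⟨N, hN⟩ := pow_unbounded_of_one_lt (2 * y / T) (one_lt_two (α := ℝ))
    refine ⟨max K N, le_max_left _ _, ?_⟩
    rw [div_lt_iff₀ hT0] at hN
    have : (2 : ℝ) ^ N ≤ 2 ^ max K N := pow_le_pow_right₀ one_le_two (le_max_right _ _)
    nlinarith
  calc _ ≤ ∑ k ∈ Finset.range (N + 1), (increment M k : ℝ) * l k :=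
        Finset.sum_le_sum_of_subset_of_nonneg (Finset.range_mono (by omega))
          fun k _ _ => mul_nonneg (Nat.cast_nonneg _) (hl0 k)
    _ = ∑ k ∈ Finset.range N, (M k : ℝ) * (l k - l (k + 1)) := by
        rw [sum_increment_mul hmono, hlz N hN, mul_zero, add_zero]
    _ ≤ 1 / 32 * φ (4 * y) := by
        refine (hstep N).trans ?_
        have h1 : φ (min (T * 2 ^ N) (4 * y)) ≤ φ (4 * y) :=
          hφm (le_min (by positivity) (by positivity)) (min_le_right _ _)
        have h2 := hφ.nonneg (min (T * 2 ^ 0) (4 * y)) (le_min (by positivity) (by positivity))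
        refine mul_le_mul_of_nonneg_left ?_ (by norm_num)
        exact (sub_le_self _ h2).trans h1
    _ ≤ φ y / 2 := by
        have h1 := apply_two_mul_le hA hanti hyA
        have h2 := apply_two_mul_le hA hanti (show A ≤ 2 * y by linarith)
        rw [show 2 * (2 * y) = 4 * y by ring] at h2
        linarith

lemma integral_div_le_sum (hφ : IsWeight φ) {T : ℝ} (hT : 0 < T) (N : ℕ) :
    ∫ x in (0 : ℝ)..T * 2 ^ N, φ x / (x ^ 2 + 1) ≤ (∫ x in (0 : ℝ)..T, φ x / (x ^ 2 + 1)) +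
      2 * ∑ k ∈ Finset.range N, φ (T * 2 ^ (k + 1)) / (T * 2 ^ (k + 1)) := by
  induction N with
  | zero => simp
  | succ N ih =>
    rw [Finset.sum_range_succ, ← hφ.integral_div_add (a := T * 2 ^ N) (by positivity)
      (by positivity)]
    have hpos : 0 < T * 2 ^ N := by positivity
    have hT' : T * 2 ^ (N + 1) = 2 * (T * 2 ^ N) := by ring
    have h1 : ∫ x in T * 2 ^ N..T * 2 ^ (N + 1), φ x / (x ^ 2 + 1) ≤
        ∫ x in T * 2 ^ N..T * 2 ^ (N + 1), φ (T * 2 ^ (N + 1)) / (T * 2 ^ N) ^ 2 := by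
      refine intervalIntegral.integral_mono_on (by linarith)
        (hφ.intervalIntegrable_div (by positivity) (by positivity)) (by simp) fun x hx => ?_
      have hx0 : 0 < x := hpos.trans_le hx.1
      have h2 : φ x ≤ φ (T * 2 ^ (N + 1)) :=
        hφ.strictMonoOn.monotoneOn hx0.le (mem_Ici.2 (by positivity)) hx.2
      have h3 : (T * 2 ^ N) ^ 2 ≤ x ^ 2 + 1 := by nlinarith [hx.1]
      have h4 := (hφ.nonneg x hx0.le).trans h2
      gcongr
    rw [intervalIntegral.integral_const, smul_eq_mul] at h1
    have e : (T * 2 ^ (N + 1) - T * 2 ^ N) * (φ (T * 2 ^ (N + 1)) / (T * 2 ^ N) ^ 2) =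
        2 * (φ (T * 2 ^ (N + 1)) / (T * 2 ^ (N + 1))) := by
      rw [pow_succ]; field_simp; norm_num
    linarith

/-- With `u_k = φ(t_k)/t_k`, the difference of `φ` divided by `t_k` is `2 u_{k+1} - u_k`, so after
telescoping one full copy of each `u_{k+1}` survives. The floors lose at most `∑ 1/t_k ≤ 2`. -/
lemma le_sum_dyadicDegree_div {T : ℝ} (hT : 1 ≤ T) (K : ℕ) :
    1 / 32 * (∑ k ∈ Finset.range (K + 1), φ (T * 2 ^ (k + 1)) / (T * 2 ^ (k + 1)) +
      φ (T * 2 ^ (K + 1)) / (T * 2 ^ (K + 1)) - φ T / T) - 2 ≤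
      ∑ k ∈ Finset.range (K + 1), (dyadicDegree φ T k : ℝ) / (T * 2 ^ k) := by
  have hT0 : 0 < T := by linarith
  suffices h : ∀ N : ℕ, 1 / 32 * (∑ k ∈ Finset.range N, φ (T * 2 ^ (k + 1)) / (T * 2 ^ (k + 1)) +
      φ (T * 2 ^ N) / (T * 2 ^ N) - φ T / T) - (2 - 2 / 2 ^ N) ≤
      ∑ k ∈ Finset.range N, (dyadicDegree φ T k : ℝ) / (T * 2 ^ k) by
    have := h (K + 1)
    have h2 : (0 : ℝ) < 2 / 2 ^ (K + 1) := by positivity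
    linarith
  intro N
  induction N with
  | zero => simp
  | succ N ih =>
    rw [Finset.sum_range_succ, Finset.sum_range_succ]
    have h1 := (Nat.lt_floor_add_one ((φ (T * 2 ^ (N + 1)) - φ (T * 2 ^ N)) / 32)).le
    have h2 : ((φ (T * 2 ^ (N + 1)) - φ (T * 2 ^ N)) / 32 - 1) / (T * 2 ^ N) ≤
        (dyadicDegree φ T N : ℝ) / (T * 2 ^ N) := by
      gcongr
      rw [dyadicDegree]; linarith
    have e : ((φ (T * 2 ^ (N + 1)) - φ (T * 2 ^ N)) / 32 - 1) / (T * 2 ^ N) =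
        1 / 32 * (2 * (φ (T * 2 ^ (N + 1)) / (T * 2 ^ (N + 1))) - φ (T * 2 ^ N) / (T * 2 ^ N)) -
          1 / (T * 2 ^ N) := by
      rw [pow_succ]; field_simp
    have h3 : 1 / (T * 2 ^ N) ≤ 2 / 2 ^ N - 2 / 2 ^ (N + 1) := by
      have e2 : (2 : ℝ) / 2 ^ N - 2 / 2 ^ (N + 1) = 1 / 2 ^ N := by
        rw [pow_succ]; field_simp; norm_num
      rw [e2]
      gcongr
      exact le_mul_of_one_le_left (by positivity) hT
    linarith

/-- The two-sided estimate for normally growing weights. -/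
theorem normallyGrowing_estimate (hφ : IsWeight φ) (h : NormallyGrowing φ) :
    ∃ c C : ℝ, 0 < c ∧ 0 < C ∧ ∀ᶠ n : ℕ in atTop, ∀ p : ℝ≥0∞, 1 ≤ p →
      -C * (∫ x in (0 : ℝ)..inverse φ n, φ x / (x ^ 2 + 1)) ≤
          Real.log (bestError n p (weight φ)) ∧
        Real.log (bestError n p (weight φ)) ≤
          -c * (∫ x in (0 : ℝ)..inverse φ n, φ x / (x ^ 2 + 1)) := by
  obtain ⟨A, hA, hanti, hconv⟩ := h
  obtain ⟨C, hC⟩ := hφ.exists_exp_le_bestError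
  obtain ⟨D, hD, hup⟩ := hφ.exists_bestError_le
  set T := max 1 (2 * A) with hT
  have hT1 : 1 ≤ T := le_max_left _ _
  have hTA : 2 * A ≤ T := le_max_right _ _
  have hT0 : 0 < T := by linarith
  set E := Real.log D + 4 / 3 + 1 / 12 * (1 / 32 * (φ T / T) + 2) +
    1 / 2304 * ∫ x in (0 : ℝ)..T, φ x / (x ^ 2 + 1) with hE
  -- Here `304 = 2·16 + 16 + 16·16`, from `n/a ≤ 16 I`. Also `2304 = 12·32·6`: value at `i`, choice
  -- of degrees, and `I ≤ const + 6 U`. It is doubled because half of the gain absorbs `E`.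
  refine ⟨1 / 4608, 304 + |C|, by norm_num, by positivity, ?_⟩
  filter_upwards [hφ.eventually_inverse (2 * T), hφ.eventually_le_integral_div 1,
    hφ.eventually_le_integral_div (4608 * E)] with n ⟨ha, hφa⟩ hI1 hIE p hp
  set a := inverse φ n with hadef
  set I := ∫ x in (0 : ℝ)..a, φ x / (x ^ 2 + 1) with hI
  have ha0 : 0 < a := by linarith
  have hlow := hC n a (by linarith) p hp
  have hE0 : 0 < bestError n p (weight φ) := (Real.exp_pos _).trans_le hlow
  constructor
  -- Doubling gives `φ ≥ n/4` on `[a/2, a]`, so this half of the interval alone contributes at least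
  -- `n/(16 a)`.
  · have hna : n / a ≤ 16 * I := by
      have h1 : n / 4 ≤ φ (a / 2) := by
        have := apply_two_mul_le hA hanti (show A ≤ a / 2 by linarith)
        rw [mul_div_cancel₀ a two_ne_zero, hφa] at this
        linarith
      have h2 : ∫ x in a / 2..a, (n / 4 / (2 * a ^ 2) : ℝ) ≤
          ∫ x in a / 2..a, φ x / (x ^ 2 + 1) := by
        refine intervalIntegral.integral_mono_on (by linarith) (by simp)
          (hφ.intervalIntegrable_div (by positivity) ha0.le) fun x hx => ?_
        have hx0 : 0 < x := by linarith [hx.1]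
        have h3 : φ (a / 2) ≤ φ x :=
          hφ.strictMonoOn.monotoneOn (mem_Ici.2 (by positivity)) hx0.le hx.1
        have h4 : x ^ 2 + 1 ≤ 2 * a ^ 2 := by nlinarith [hx.2]
        have h5 := hφ.nonneg x hx0.le
        gcongr
        exact h1.trans h3
      rw [intervalIntegral.integral_const, smul_eq_mul] at h2
      have h3 := hφ.integral_div_add (a := a / 2) (b := a) (by positivity) ha0.le
      have h4 := hφ.integral_div_nonneg le_rfl (show 0 ≤ a / 2 by positivity)
      have e : (a - a / 2) * (n / 4 / (2 * a ^ 2)) = 1 / 16 * (n / a) := by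
        field_simp; ring
      rw [e] at h2
      linarith
    rw [Real.le_log_iff_exp_le hE0]
    refine le_trans (Real.exp_le_exp.2 ?_) hlow
    rw [hφa, neg_mul, neg_le_neg_iff]
    have h5 : C ≤ |C| * I := (le_abs_self _).trans (le_mul_of_one_le_right (abs_nonneg _) hI1)
    linarith
  -- `K` is maximal with `T 2^(K+1) ≤ a`: the degree, controlled by `φ(T 2^(K+1)) ≤ n`, is
  -- admissible, and `a < T 2^(K+2)` leaves at most one dyadic block uncovered, which doubling
  -- handles.
  · obtain ⟨K, hK1, hK2⟩ := exists_nat_pow_near (x := a / (2 * T)) (y := 2)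
      ((one_le_div (by positivity)).2 ha) one_lt_two
    rw [le_div_iff₀ (by positivity)] at hK1
    rw [div_lt_iff₀ (by positivity)] at hK2
    have hmono := monotone_dyadicDegree hA hconv (show A ≤ T by linarith)
    set P := dyadicProduct (dyadicDegree φ T) T K with hP
    have hTK : 0 < T * 2 ^ K := by positivity
    have hφm : ∀ {u v : ℝ}, 0 ≤ u → u ≤ v → φ u ≤ φ v := fun hu huv =>
      hφ.strictMonoOn.monotoneOn hu (hu.trans huv) huv
    have hTK1 : T * 2 ^ (K + 1) ≤ a := by rw [pow_succ]; linarith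
    have hdeg : P.natDegree ≤ n := by
      refine (natDegree_dyadicProduct_le hmono T K).trans (Nat.floor_le_of_le ?_)
      have h1 : φ (T * 2 ^ (K + 1)) ≤ n := hφa ▸ hφm (by positivity) hTK1
      have h2 := hφ.nonneg (T * 2 ^ K) hTK.le
      have : (0 : ℝ) ≤ n := Nat.cast_nonneg n
      linarith
    have hPI := exp_le_norm_eval_dyadicProduct_I hmono hT1 K
    have hPI0 : 0 < ‖P.eval Complex.I‖ := (Real.exp_pos _).trans_le hPI
    have hbd := hup n P (Real.exp (4 / 3)) hdeg (norm_pos_iff.1 hPI0) (Real.exp_pos _).le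
      (fun x => by
        rw [← Real.exp_add]
        refine (norm_eval_dyadicProduct_le _ hT0 K x).trans (Real.exp_le_exp.2 ?_)
        gcongr
        exact hφ.sum_dyadicDegree_mul_le hA hanti hconv hTA (abs_nonneg x) K) p hp
    set U := ∑ k ∈ Finset.range (K + 1), φ (T * 2 ^ (k + 1)) / (T * 2 ^ (k + 1)) with hU
    set V := ∑ k ∈ Finset.range (K + 1), (dyadicDegree φ T k : ℝ) / (T * 2 ^ k) with hV
    have hVU : 1 / 32 * (U + φ (T * 2 ^ (K + 1)) / (T * 2 ^ (K + 1)) - φ T / T) - 2 ≤ V :=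
      le_sum_dyadicDegree_div hT1 K
    have hu : ∀ k : ℕ, 0 ≤ φ (T * 2 ^ k) / (T * 2 ^ k) := fun k =>
      div_nonneg (hφ.nonneg _ (by positivity)) (by positivity)
    have hIU : I ≤ (∫ x in (0 : ℝ)..T, φ x / (x ^ 2 + 1)) + 6 * U := by
      have h1 : a ≤ T * 2 ^ (K + 2) := by
        rw [show T * 2 ^ (K + 2) = 2 ^ (K + 1) * (2 * T) by ring]; exact hK2.le
      have h2 := hφ.integral_div_mono ha0.le h1
      have h3 := hφ.integral_div_le_sum hT0 (K + 2)
      rw [Finset.sum_range_succ, ← hU] at h3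
      have h4 : φ (T * 2 ^ (K + 1 + 1)) / (T * 2 ^ (K + 1 + 1)) ≤
          2 * (φ (T * 2 ^ (K + 1)) / (T * 2 ^ (K + 1))) := by
        have h5 := apply_two_mul_le hA hanti (show A ≤ T * 2 ^ (K + 1) by
          have : T ≤ T * 2 ^ (K + 1) := le_mul_of_one_le_right hT0.le (one_le_pow₀ one_le_two)
          linarith)
        rw [show T * 2 ^ (K + 1 + 1) = 2 * (T * 2 ^ (K + 1)) by ring]
        calc _ ≤ 4 * φ (T * 2 ^ (K + 1)) / (2 * (T * 2 ^ (K + 1))) := by gcongr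
          _ = _ := by field_simp; ring
      have h6 : φ (T * 2 ^ (K + 1)) / (T * 2 ^ (K + 1)) ≤ U :=
        Finset.single_le_sum (f := fun k => φ (T * 2 ^ (k + 1)) / (T * 2 ^ (k + 1)))
          (fun k _ => hu (k + 1)) (Finset.self_mem_range_succ K)
      linarith
    have h1 : bestError n p (weight φ) ≤ Real.exp (Real.log D + (4 / 3 - 1 / 12 * V)) := by
      rw [Real.exp_add, Real.exp_log (by linarith), Real.exp_sub]
      refine hbd.trans ?_
      gcongr
    have h2 := (Real.log_le_iff_le_exp hE0).2 h1
    have h3 := hu (K + 1)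
    linarith

end IsWeight

end WeightedApprox

end

theorem theorem3 (φ : ℝ → ℝ) (hφ : WeightedApprox.IsWeight φ) :
    (WeightedApprox.RapidlyGrowing φ →
      ∃ c C : ℝ, 0 < c ∧ 0 < C ∧ ∀ᶠ n : ℕ in atTop, ∀ p : ℝ≥0∞, 1 ≤ p →
        -C * (n / WeightedApprox.inverse φ n)
            ≤ Real.log (WeightedApprox.bestError n p (WeightedApprox.weight φ)) ∧
          Real.log (WeightedApprox.bestError n p (WeightedApprox.weight φ))
            ≤ -c * (n / WeightedApprox.inverse φ n)) ∧
    (WeightedApprox.NormallyGrowing φ →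
      ∃ c C : ℝ, 0 < c ∧ 0 < C ∧ ∀ᶠ n : ℕ in atTop, ∀ p : ℝ≥0∞, 1 ≤ p →
        -C * (∫ x in (0 : ℝ)..WeightedApprox.inverse φ n, φ x / (x ^ 2 + 1))
            ≤ Real.log (WeightedApprox.bestError n p (WeightedApprox.weight φ)) ∧
          Real.log (WeightedApprox.bestError n p (WeightedApprox.weight φ))
            ≤ -c * (∫ x in (0 : ℝ)..WeightedApprox.inverse φ n, φ x / (x ^ 2 + 1))) :=
  ⟨hφ.rapidlyGrowing_estimate, hφ.normallyGrowing_estimate⟩
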